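/- **Corollary 7.2.** Let $\lambda>0$, $p>1$, $\mu,\tau,\varsigma>0$, let $m\ge 0$ be an integer and let $0=t_0<s_0<t_1<s_1<\dots<t_m<s_m=L$ satisfy $s_i-t_i=\tau$ for $0\le i\le m$ and $t_{i+1}-s_i=\varsigma$ for $0\le i\le m-1$. Let $a(t)=\mu$ for $t\in[t_i,s_i]$, $0\le i\le m$, and $a(t)=0$ otherwise. Let $\hat r_0,\hat r_L\subset\mathbb R^2$ be arcs (injective continuous images of $[0,\infty)$) linking the origin to infinity, contained in the closed quadrants $Q_0$ and $Q_L$ respectively. Consider the problem $$-u''=\lambda u+a(t)|u|^{p-1}u\ \text{ on }[0,L],\qquad (u(0),u'(0))\in\hat r_0,\qquad (u(L),u'(L))\in\hat r_L, \tag{P}$$ where a solution is a $C^1$ function $u$ on $[0,L]$ with $u'$ absolutely continuous which satisfies the equation almost everywhere. For $c>0$ let $x_+(c)>0$ be the solution of $\frac{\lambda}{2}x^2+\frac{\mu}{p+1}x^{p+1}=c$ and $$\mathcal T(c)=4\int_0^1\frac{d\sigma}{\sqrt{\lambda(1-\sigma^2)+\frac{2\mu}{p+1}x_+(c)^{p-1}(1-\sigma^{p+1})}}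 .$$ Assume that there are $0<c_1<c_2$, integers $0\le\alpha<\beta$ and an integer $\xi\ge 0$ such that $$(\alpha+\tfrac12)\mathcal T(c_1)>\tau>(\beta+\tfrac12)\mathcal T(c_2)\quad\text{for } i=1,\dots,m-1,$$ $$(\alpha+\tfrac14)\mathcal T(c_1)>\tau>(\beta+\tfrac12)\mathcal T(c_2)\quad\text{for } i=0,m,$$ $$\sqrt{\frac{2c_1}{\lambda}}>x_{\rm com}:=\Big(\frac{(p+1)(c_2-c_1)}{\mu}\Big)^{\frac1{p+1}},$$ $$2\int_0^{x_{\rm com}}\frac{dx}{\sqrt{2c_1-\lambda x^2}}+\frac{2\pi\xi}{\sqrt\lambda}\ \le\ \varsigma\ \le\ \frac{\pi}{2\sqrt\lambda}+\frac{2\pi\xi}{\sqrt\lambda}.$$ Then (P) has at least $2^m(\beta-\alpha)^{m+1}$ solutions. Moreover, such solutions can be classified by their nodal behavior. Let $\mathcal A=\{(x,y): c_1\le \frac12y^2+\frac\lambda2x^2+\frac{\mu}{p+1}|x|^{p+1}\le c_2\}$, and let $\mathcal A_{I},\dots,\mathcal A_{IV}$ be its intersections with the closed quadrants. There are solutions $u_{\kappa,j}$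 of (P), one for each itinerary $\kappa=(\kappa_1,\dots,\kappa_m)\in\{I,III\}^m$ and each $j=(j_0,\dots,j_m)\in\{1,\dots,\beta-\alpha\}^{m+1}$, which are pairwise distinct on $[0,L]$ and such that $u=u_{\kappa,j}$ has the following properties. 1. $(u(0),u'(0))\in\mathcal A\cap Q_0$ and $(u(L),u'(L))\in\mathcal A\cap Q_L$. For $1\le i\le m$, $(u(t_i),u'(t_i))\in\mathcal A_{\kappa_i}$, and $(u(s_{i-1}),u'(s_{i-1}))$ lies in $\mathcal A_{II}\cup\mathcal A_{III}$ if $\kappa_i=I$ and in $\mathcal A_{IV}\cup\mathcal A_{I}$ if $\kappa_i=III$. 2. On each gap $(s_i,t_{i+1})$, $0\le i\le m-1$, $u$ has exactly $2\xi+1$ zeros and $u'$ has exactly $2\xi$ zeros. 3. For $1\le i\le m-1$, $u$ has in $(t_i,s_i)$ exactly $2(\alpha+j_i)-1$ zeros if $\kappa_i=\kappa_{i+1}$ and exactly $2(\alpha+j_i)$ zeros if $\kappa_i\ne\kappa_{i+1}$, and $u'$ has in $(t_i,s_i)$ exactly one zero more than $u$. 4. If $m\ge1$, the numbers of zeros of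 $u$ given in 3 also hold on the first and last humps ($i=0$ and $i=m$), where $\kappa_0=I$ if $Q_0$ is the first or fourth quadrant and $\kappa_0=III$ otherwise, $\kappa_{m+1}=I$ if $Q_L$ is the second or third quadrant and $\kappa_{m+1}=III$ otherwise. Here the zeros are counted in the open interval, except that a zero at $t=0$ is also counted if $Q_0$ is the second or fourth quadrant, and a zero at $t=L$ is also counted if $Q_L$ is the first or third quadrant. -/

import Mathlib

open Set Filter Topology MeasureTheory

namespace MooreNehari

/-- The stepwise weight `a(t)`, equal to `μ i` on the hump `[t i, s i]` and to `0` elsewhere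
(the humps are pairwise disjoint in all uses). -/
noncomputable def stepWeight {m : ℕ} (t s μ : Fin (m + 1) → ℝ) (x : ℝ) : ℝ :=
  ∑ i, (Icc (t i) (s i)).indicator (fun _ => μ i) x

/-- The derivative `u'` of `u` on `[0, L]` (one-sided at the two end points). -/
noncomputable def slope (L : ℝ) (u : ℝ → ℝ) : ℝ → ℝ := derivWithin u (Icc 0 L)

/-- The point `(u(x), u'(x))` of the phase plane. -/
noncomputable def phase (L : ℝ) (u : ℝ → ℝ) (x : ℝ) : ℝ × ℝ := (u x, slope L u x)

/-- `u` solves `-u'' = lam u + a(x) |u|^(p-1) u` on `[0, L]` in the Carathéodory sense (`u` is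
`C¹`, `u'` is absolutely continuous, the equation holds almost everywhere) together with
`(u(0), u'(0)) ∈ r₀` and `(u(L), u'(L)) ∈ r_L`. -/
structure IsSolution (lam p L : ℝ) (a : ℝ → ℝ) (r₀ r_L : Set (ℝ × ℝ)) (u : ℝ → ℝ) : Prop where
  contDiffOn : ContDiffOn ℝ 1 u (Icc 0 L)
  absolutelyContinuous : AbsolutelyContinuousOnInterval (slope L u) 0 L
  equation : ∀ᵐ x : ℝ, x ∈ Ioo 0 L →
    HasDerivAt (slope L u) (-(lam * u x + a x * |u x| ^ (p - 1) * u x)) x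
  left_mem : phase L u 0 ∈ r₀
  right_mem : phase L u L ∈ r_L

/-- The four quadrants of the plane, numbered counterclockwise as usual. -/
inductive Quadrant
  | I
  | II
  | III
  | IV

/-- The closed quadrant as a subset of the plane. -/
def Quadrant.region : Quadrant → Set (ℝ × ℝ)
  | .I => {z | 0 ≤ z.1 ∧ 0 ≤ z.2}
  | .II => {z | z.1 ≤ 0 ∧ 0 ≤ z.2}
  | .III => {z | z.1 ≤ 0 ∧ z.2 ≤ 0}
  | .IV => {z | 0 ≤ z.1 ∧ z.2 ≤ 0}

/-- `r` is an arc (homeomorphic image of `[0, ∞)`) linking the origin to infinity. -/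
def IsUnboundedArc (r : Set (ℝ × ℝ)) : Prop :=
  ∃ γ : ℝ → ℝ × ℝ, ContinuousOn γ (Ici 0) ∧ InjOn γ (Ici 0) ∧ γ 0 = (0, 0) ∧
    Tendsto γ atTop (cocompact (ℝ × ℝ)) ∧ r = γ '' Ici 0

/-- The potential `lam x² / 2 + μ x^(p+1) / (p+1)` for `x ≥ 0`. -/
noncomputable def potential (lam μ p x : ℝ) : ℝ := lam / 2 * x ^ 2 + μ / (p + 1) * x ^ (p + 1)

/-- The Hamiltonian of `x' = y`, `y' = -lam x - μ |x|^(p-1) x`. -/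
noncomputable def hamiltonian (lam μ p : ℝ) (z : ℝ × ℝ) : ℝ :=
  1 / 2 * z.2 ^ 2 + potential lam μ p |z.1|

/-- The closed annulus between the energy levels `c₁` and `c₂`. -/
def annulus (lam μ p c₁ c₂ : ℝ) : Set (ℝ × ℝ) :=
  {z | c₁ ≤ hamiltonian lam μ p z ∧ hamiltonian lam μ p z ≤ c₂}

/-- The abscissa `x₊(c)` where the level line of energy `c` meets the positive `x`-axis, that is,
the positive root of `potential x = c`; see `xPlus_spec` and `eq_xPlus`. -/
noncomputable def xPlus (lam μ p c : ℝ) : ℝ := sSup {x | 0 ≤ x ∧ potential lam μ p x ≤ c}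

/-- The period of the closed orbit through `(x, 0)`, `x > 0`. -/
noncomputable def orbitPeriod (lam μ p x : ℝ) : ℝ :=
  4 * ∫ σ in (0 : ℝ)..1,
    1 / √(lam * (1 - σ ^ 2) + 2 * μ / (p + 1) * x ^ (p - 1) * (1 - σ ^ (p + 1)))

/-- The period `𝒯(c)` of the closed orbit of energy `c`. -/
noncomputable def energyPeriod (lam μ p c : ℝ) : ℝ := orbitPeriod lam μ p (xPlus lam μ p c)

/-- The abscissa `x_com` where the orbit `y² + lam x² = 2 c₁` of the linear system meets the level
line of energy `c₂`. -/
noncomputable def xCom (μ p c₁ c₂ : ℝ) : ℝ := ((p + 1) * (c₂ - c₁) / μ) ^ (1 / (p + 1))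

theorem potential_strictMonoOn {lam μ p : ℝ} (hlam : 0 < lam) (hμ : 0 < μ) (hp : 1 < p) :
    StrictMonoOn (potential lam μ p) (Ici 0) := by
  intro x hx y hy hxy
  have hx' : (0 : ℝ) ≤ x := hx
  have h1 : x ^ 2 < y ^ 2 := by gcongr
  have h2 : x ^ (p + 1) < y ^ (p + 1) := Real.rpow_lt_rpow hx' hxy (by linarith)
  have h3 : 0 < μ / (p + 1) := by positivity
  unfold potential
  have h4 : lam / 2 * x ^ 2 < lam / 2 * y ^ 2 := by gcongr
  have h5 : μ / (p + 1) * x ^ (p + 1) < μ / (p + 1) * y ^ (p + 1) := by gcongr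
  linarith

theorem eq_xPlus {lam μ p c x : ℝ} (hlam : 0 < lam) (hμ : 0 < μ) (hp : 1 < p)
    (hx : 0 ≤ x) (h : potential lam μ p x = c) : x = xPlus lam μ p c := by
  have hset : {y | 0 ≤ y ∧ potential lam μ p y ≤ c} = Icc 0 x := by
    ext y
    constructor
    · rintro ⟨h0, h1⟩
      rw [← h] at h1
      exact ⟨h0, ((potential_strictMonoOn hlam hμ hp).le_iff_le h0 hx).1 h1⟩
    · rintro ⟨h0, h1⟩
      refine ⟨h0, ?_⟩
      rw [← h]
      exact ((potential_strictMonoOn hlam hμ hp).le_iff_le h0 hx).2 h1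
  unfold xPlus
  rw [hset, csSup_Icc hx]

theorem xPlus_spec {lam μ p c : ℝ} (hlam : 0 < lam) (hμ : 0 < μ) (hp : 1 < p) (hc : 0 < c) :
    0 < xPlus lam μ p c ∧ potential lam μ p (xPlus lam μ p c) = c := by
  have hp1 : p + 1 ≠ 0 := by linarith
  have h0 : potential lam μ p 0 = 0 := by simp [potential, Real.zero_rpow hp1]
  have hcont : Continuous (potential lam μ p) := by
    unfold potential
    have : Continuous fun x : ℝ => x ^ (p + 1) :=
      Real.continuous_rpow_const (by linarith)
    fun_prop
  have hX : (0 : ℝ) ≤ √(2 * c / lam) := Real.sqrt_nonneg _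
  have hbig : c ≤ potential lam μ p (√(2 * c / lam)) := by
    unfold potential
    have h1 : √(2 * c / lam) ^ 2 = 2 * c / lam := Real.sq_sqrt (by positivity)
    have h2 : 0 ≤ μ / (p + 1) * √(2 * c / lam) ^ (p + 1) := by positivity
    rw [h1]
    have h3 : lam / 2 * (2 * c / lam) = c := by field_simp
    linarith
  obtain ⟨x, hx, hxc⟩ := intermediate_value_Icc hX hcont.continuousOn
    (show c ∈ Icc _ _ from ⟨by rw [h0]; exact hc.le, hbig⟩)
  rw [← eq_xPlus hlam hμ hp hx.1 hxc]
  refine ⟨lt_of_le_of_ne hx.1 ?_, hxc⟩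
  rintro rfl
  rw [h0] at hxc
  exact hc.ne hxc

/-- The vertices of the transition diagram at the beginning of a hump: the parts of the annulus in
the first and in the third quadrant. -/
inductive Block
  | I
  | III

def Block.quadrant : Block → Quadrant
  | .I => .I
  | .III => .III

/-- Where a solution has to be at the beginning of a gap in order to enter block `b` at its end:
the half annulus in quadrants II and III for `b = I`, in quadrants IV and I for `b = III`. -/
def Block.source : Block → Set (ℝ × ℝ)
  | .I => Quadrant.II.region ∪ Quadrant.III.region
  | .III => Quadrant.IV.region ∪ Quadrant.I.region

/-- The block lying in the same half-plane `x ≥ 0` or `x ≤ 0` as the quadrant. -/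
def Quadrant.sameSide : Quadrant → Block
  | .I => .I
  | .IV => .I
  | .II => .III
  | .III => .III

/-- The block lying in the other half-plane, into which a gap transition leads. -/
def Quadrant.otherSide : Quadrant → Block
  | .I => .III
  | .IV => .III
  | .II => .I
  | .III => .I

/-- The itinerary `κ₁, …, κₘ` (`κᵢ` is the block at the time `tᵢ`, stored with index `i - 1`),
completed at both ends: at index `0` by the side of the initial quadrant `q₀`, and at index `m + 1`
by the side opposite to the final quadrant `q_L`. -/
def fullItinerary {m : ℕ} (q₀ q_L : Quadrant) (κ : Fin m → Block) : Fin (m + 2) → Block :=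
  Fin.cons q₀.sameSide (Fin.snoc κ q_L.otherSide : Fin (m + 1) → Block)

open Classical in
/-- The number of zeros of a solution on a hump at whose beginning and end the completed itinerary
has the entries `b` and `b'`. -/
noncomputable def humpNodes (α j : ℕ) (b b' : Block) : ℕ :=
  if b = b' then 2 * (α + j) - 1 else 2 * (α + j)

/-- The open hump `(t i, s i)`; the initial time `0 = t 0` is added on the first hump if `q₀` is
II or IV, and the final time `L = s m` is added on the last hump if `q_L` is I or III. (Orbits run
clockwise: they leave II and IV, and enter I and III, across the `y`-axis.) -/
def humpTimes {m : ℕ} (t s : Fin (m + 1) → ℝ) (q₀ q_L : Quadrant) (i : Fin (m + 1)) : Set ℝ :=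
  {x | x ∈ Icc (t i) (s i) ∧ (x = t i → i = 0 ∧ (q₀ = .II ∨ q₀ = .IV)) ∧
    (x = s i → i = Fin.last m ∧ (q_L = .I ∨ q_L = .III))}

/-- `u` follows the itinerary `κ` in the annulus `A`, with the oscillation numbers `j` on the humps
and `ξ` complete turns around the origin on each gap. -/
structure HasItinerary {m : ℕ} (t s : Fin (m + 1) → ℝ) (A : Set (ℝ × ℝ)) (q₀ q_L : Quadrant)
    (α ξ : ℕ) (κ : Fin m → Block) (j : Fin (m + 1) → ℕ) (u : ℝ → ℝ) : Prop where
  /-- the position at the initial time -/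
  initial : phase (s (Fin.last m)) u 0 ∈ A ∩ q₀.region
  /-- the position at the final time -/
  final : phase (s (Fin.last m)) u (s (Fin.last m)) ∈ A ∩ q_L.region
  /-- the position at the end of a hump that is followed by a gap -/
  gap_start : ∀ i : Fin m, phase (s (Fin.last m)) u (s i.castSucc) ∈ A ∩ (κ i).source
  /-- the position at the beginning of a hump that is preceded by a gap -/
  gap_end : ∀ i : Fin m, phase (s (Fin.last m)) u (t i.succ) ∈ A ∩ (κ i).quadrant.region
  /-- zeros of `u` on the gaps -/
  gap_zeros : ∀ i : Fin m,
    {x | x ∈ Ioo (s i.castSucc) (t i.succ) ∧ u x = 0}.encard = ((2 * ξ + 1 : ℕ) : ℕ∞)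
  /-- zeros of `u'` on the gaps -/
  gap_slope_zeros : ∀ i : Fin m,
    {x | x ∈ Ioo (s i.castSucc) (t i.succ) ∧ slope (s (Fin.last m)) u x = 0}.encard =
      ((2 * ξ : ℕ) : ℕ∞)
  /-- zeros of `u` on the humps -/
  hump_zeros : 1 ≤ m → ∀ i : Fin (m + 1),
    {x | x ∈ humpTimes t s q₀ q_L i ∧ u x = 0}.encard =
      (humpNodes α (j i) (fullItinerary q₀ q_L κ i.castSucc)
        (fullItinerary q₀ q_L κ i.succ) : ℕ∞)
  /-- zeros of `u'` on the inner humps: one more than those of `u` -/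
  hump_slope_zeros : ∀ i : Fin (m + 1), i ≠ 0 → i ≠ Fin.last m →
    {x | x ∈ Ioo (t i) (s i) ∧ slope (s (Fin.last m)) u x = 0}.encard =
      ((humpNodes α (j i) (fullItinerary q₀ q_L κ i.castSucc)
        (fullItinerary q₀ q_L κ i.succ) + 1 : ℕ) : ℕ∞)

end MooreNehari

open MooreNehari

/-! Both parts of the equation are integrated explicitly, so only planar topology is needed to find
solutions. On a hump let w be the signed square root of twice the potential. The energy is then (w²
+ y²)/2, and an orbit of energy c turns clockwise in the (w, y)-plane with a positive speed
depending on c and the angle. The time needed to reach an angle is `clock`, its inverse `angle`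
gives the orbit, and `energyPeriod_eq` identifies 𝒯(c) with four times `quarter`. On a gap, orbits
rotate uniformly on the ellipses y² + λx² = ρ².

By the twist conditions a hump turns the boundary c₁ of the annulus by less than 4α+2 quarter turns
(4α+1 on the end humps), and the boundary c₂ by more than 4β+2. A path that joins the two boundaries
inside one quadrant is therefore stretched across every quarter-turn sector in between. Fixing a
sector fixes the number N of zeros on the hump; before a gap the sector is quadrant II, up to
central symmetry.

A gap acts, modulo ξ complete turns, as a rotation by θ = √λ ς − 2πξ in (0, π/2]. The hump energy is
the linear energy ρ²/2, constant on the gap, plus the nonlinear potential, which vanishes on the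
y-axis. A point leaving the y-axis with energy at least c₁ ends beyond the abscissa x_com and has
gained more than c₂ − c₁. A point of energy at most c₂ that arrives on the y-axis has,
symmetrically, fallen below c₁. Hence the piece of the path in the sector of linear angles [−θ, 0]
is mapped to one with a subpath that again joins both boundaries, now in quadrant I
(`hasCrossing_link`). The argument can be repeated from hump to hump, starting with the arc at 0
(`exists_chain`). On the last hump the stretched path joins two opposite sides of an energy-angle
rectangle and the arc at L joins the other two, so they meet (`exists_crossing`).

When there is at least one gap, the admissible N on a hump are 2α+1, …, 2β. Consecutive blocks agree
exactly when N is odd, so each j gives one N for either choice of the next block. The itinerary and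
the numbers N can be read off from u, which makes the solutions distinct. -/

namespace MooreNehari

/-- The parameters of the autonomous oscillator `x'' = -lam x - μ |x|^(p-1) x`. -/
structure Oscillator where
  lam : ℝ
  μ : ℝ
  p : ℝ
  lam_pos : 0 < lam
  μ_pos : 0 < μ
  one_lt_p : 1 < p

/-! ### Energy-angle coordinates and the explicit flow on a hump -/

namespace Oscillator

variable (O : Oscillator)

/-- The square root of `2 V(x) / x²`, where `V` is the potential. -/
noncomputable def stiffness (x : ℝ) : ℝ :=
  √(O.lam + 2 * O.μ / (O.p + 1) * |x| ^ (O.p - 1))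

/-- The signed square root of twice the potential. -/
noncomputable def coord (x : ℝ) : ℝ := x * O.stiffness x

/-- The derivative of `coord`. -/
noncomputable def speed (x : ℝ) : ℝ := (O.lam + O.μ * |x| ^ (O.p - 1)) / O.stiffness x

theorem p_add_one_pos : 0 < O.p + 1 := by linarith [O.one_lt_p]

theorem stiffness_arg_pos (x : ℝ) : 0 < O.lam + 2 * O.μ / (O.p + 1) * |x| ^ (O.p - 1) := by
  have := O.lam_pos
  have := O.μ_pos
  have := O.p_add_one_pos
  positivity

theorem stiffness_pos (x : ℝ) : 0 < O.stiffness x := Real.sqrt_pos.2 (O.stiffness_arg_pos x)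

theorem sqrt_lam_le_stiffness (x : ℝ) : √O.lam ≤ O.stiffness x := by
  apply Real.sqrt_le_sqrt
  have := O.μ_pos
  have := O.p_add_one_pos
  have : 0 ≤ 2 * O.μ / (O.p + 1) * |x| ^ (O.p - 1) := by positivity
  linarith

theorem speed_pos (x : ℝ) : 0 < O.speed x := by
  have := O.lam_pos
  have := O.μ_pos
  have := O.stiffness_pos x
  unfold speed
  positivity

theorem continuous_abs_rpow : Continuous fun x : ℝ => |x| ^ (O.p - 1) :=
  continuous_abs.rpow_const fun _ => Or.inr (by linarith [O.one_lt_p])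

theorem continuous_stiffness : Continuous O.stiffness := by
  have := O.continuous_abs_rpow
  unfold stiffness
  fun_prop

theorem continuous_speed : Continuous O.speed := by
  have := O.continuous_abs_rpow
  exact Continuous.div (by fun_prop) O.continuous_stiffness fun x => (O.stiffness_pos x).ne'

theorem continuous_coord : Continuous O.coord := continuous_id.mul O.continuous_stiffness

theorem stiffness_neg (x : ℝ) : O.stiffness (-x) = O.stiffness x := by simp [stiffness]

theorem speed_neg (x : ℝ) : O.speed (-x) = O.speed x := by simp [speed, stiffness_neg]

theorem coord_neg (x : ℝ) : O.coord (-x) = -O.coord x := by simp [coord, stiffness_neg]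

theorem coord_zero : O.coord 0 = 0 := by simp [coord]

/-- The right-hand side is V'(x). With w = `coord x` the hump system becomes w' = `speed x` · y, y'
= −`speed x` · w, a clockwise rotation with angular velocity `speed x`. -/
theorem coord_mul_speed (x : ℝ) :
    O.coord x * O.speed x = O.lam * x + O.μ * |x| ^ (O.p - 1) * x := by
  have := (O.stiffness_pos x).ne'
  unfold coord speed
  field_simp

theorem stiffness_sq (x : ℝ) :
    O.stiffness x ^ 2 = O.lam + 2 * O.μ / (O.p + 1) * |x| ^ (O.p - 1) :=
  Real.sq_sqrt (O.stiffness_arg_pos x).le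

theorem abs_rpow_sub_one_mul_sq (x : ℝ) : |x| ^ (O.p - 1) * x ^ 2 = |x| ^ (O.p + 1) := by
  have hp := O.one_lt_p
  rcases eq_or_ne x 0 with rfl | hx
  · have : O.p + 1 ≠ 0 := by linarith
    simp [Real.zero_rpow this]
  · rw [← sq_abs, ← Real.rpow_natCast, ← Real.rpow_add (abs_pos.2 hx)]
    congr 1
    push_cast
    ring

theorem coord_sq (x : ℝ) : O.coord x ^ 2 = 2 * potential O.lam O.μ O.p |x| := by
  unfold coord potential
  rw [mul_pow, stiffness_sq, sq_abs, ← abs_rpow_sub_one_mul_sq]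
  ring

theorem hamiltonian_eq (z : ℝ × ℝ) :
    hamiltonian O.lam O.μ O.p z = (O.coord z.1 ^ 2 + z.2 ^ 2) / 2 := by
  rw [coord_sq]
  unfold hamiltonian
  ring

/-- The origin is treated separately, since |x|^(p−1) need not be differentiable there; the
difference quotient of `coord` at 0 is `stiffness` itself, which is continuous. -/
theorem hasDerivAt_coord (x : ℝ) : HasDerivAt O.coord (O.speed x) x := by
  have hp := O.one_lt_p
  have hp1 := O.p_add_one_pos.ne'
  rcases eq_or_ne x 0 with rfl | hx
  · rw [hasDerivAt_iff_tendsto_slope]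
    have h0 : O.speed 0 = O.stiffness 0 := by
      have h : O.p - 1 ≠ 0 := by linarith
      simp [speed, stiffness, Real.zero_rpow h, Real.div_sqrt]
    rw [h0]
    refine ((O.continuous_stiffness.tendsto 0).mono_left nhdsWithin_le_nhds).congr' ?_
    filter_upwards [self_mem_nhdsWithin] with y hy
    have hy : y ≠ 0 := hy
    rw [slope_def_field, coord_zero]
    unfold coord
    field_simp
    simp
  · have h1 : HasDerivAt (fun y : ℝ => |y| ^ (O.p - 1))
        ((O.p - 1) * |x| ^ (O.p - 1) / x) x := by
      have h := (hasDerivAt_abs hx).rpow_const (p := O.p - 1) (Or.inl (abs_pos.2 hx).ne')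
      convert h using 1
      rw [Real.rpow_sub_one (abs_pos.2 hx).ne' (O.p - 1)]
      rcases hx.lt_or_gt with h | h
      · rw [abs_of_neg h, sign_neg h]
        field_simp
        simp
      · rw [abs_of_pos h, sign_pos h]
        field_simp
        simp
    have h2 : HasDerivAt O.stiffness _ x :=
      ((h1.const_mul (2 * O.μ / (O.p + 1))).const_add O.lam).sqrt (O.stiffness_arg_pos x).ne'
    have h3 : HasDerivAt O.coord _ x := (hasDerivAt_id x).mul h2
    convert h3 using 1
    change O.speed x = 1 * O.stiffness x + x * (_ / (2 * O.stiffness x))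
    have hs := (O.stiffness_pos x).ne'
    have hs2 := O.stiffness_sq x
    unfold speed
    field_simp
    rw [hs2]
    field_simp
    ring

theorem strictMono_coord : StrictMono O.coord :=
  strictMono_of_deriv_pos fun x => by
    rw [(O.hasDerivAt_coord x).deriv]
    exact O.speed_pos x

theorem surjective_coord : Function.Surjective O.coord := by
  have hl : 0 < √O.lam := Real.sqrt_pos.2 O.lam_pos
  refine O.continuous_coord.surjective ?_ ?_
  · refine tendsto_atTop_mono' atTop ?_ (tendsto_id.const_mul_atTop hl)
    filter_upwards [eventually_ge_atTop 0] with x hx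
    have := mul_le_mul_of_nonneg_left (O.sqrt_lam_le_stiffness x) hx
    simp only [id, coord]
    linarith
  · refine tendsto_atBot_mono' atBot ?_ (tendsto_id.const_mul_atBot hl)
    filter_upwards [eventually_le_atBot 0] with x hx
    have := mul_le_mul_of_nonpos_left (O.sqrt_lam_le_stiffness x) hx
    simp only [id, coord]
    linarith

/-- `coord` as an order isomorphism of the line. -/
noncomputable def coordIso : ℝ ≃o ℝ :=
  O.strictMono_coord.orderIsoOfSurjective _ O.surjective_coord

/-- The inverse of `coord`. -/
noncomputable def coordInv (w : ℝ) : ℝ := O.coordIso.symm w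

theorem coord_coordInv (w : ℝ) : O.coord (O.coordInv w) = w := O.coordIso.apply_symm_apply w

theorem coordInv_coord (x : ℝ) : O.coordInv (O.coord x) = x := O.coordIso.symm_apply_apply x

theorem strictMono_coordInv : StrictMono O.coordInv := O.coordIso.symm.strictMono

theorem continuous_coordInv : Continuous O.coordInv := O.coordIso.symm.continuous

theorem coordInv_neg (w : ℝ) : O.coordInv (-w) = -O.coordInv w := by
  apply O.strictMono_coord.injective
  rw [coord_neg, coord_coordInv, coord_coordInv]

theorem coordInv_zero : O.coordInv 0 = 0 := by
  simpa [coord_zero] using O.coordInv_coord 0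

theorem hasDerivAt_coordInv (w : ℝ) :
    HasDerivAt O.coordInv (O.speed (O.coordInv w))⁻¹ w :=
  HasDerivAt.of_local_left_inverse O.continuous_coordInv.continuousAt
    (O.hasDerivAt_coord _) (O.speed_pos _).ne' (Eventually.of_forall O.coord_coordInv)

theorem coordInv_eq_zero {w : ℝ} : O.coordInv w = 0 ↔ w = 0 := by
  rw [← O.coordInv_zero, O.strictMono_coordInv.injective.eq_iff, coordInv_zero]

theorem coordInv_nonneg {w : ℝ} : 0 ≤ O.coordInv w ↔ 0 ≤ w := by
  rw [← O.coordInv_zero, O.strictMono_coordInv.le_iff_le, coordInv_zero]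

/-- The angular speed, in the plane with coordinates `(coord x, y)`, at the point of energy `c`
with clockwise angle `φ` from the positive `y`-axis. -/
noncomputable def rate (c φ : ℝ) : ℝ := O.speed (O.coordInv (√(2 * c) * Real.sin φ))

theorem rate_pos (c φ : ℝ) : 0 < O.rate c φ := O.speed_pos _

theorem continuous_rate : Continuous fun q : ℝ × ℝ => O.rate q.1 q.2 := by
  have h1 := O.continuous_speed
  have h2 := O.continuous_coordInv
  unfold rate
  fun_prop

theorem rate_neg (c φ : ℝ) : O.rate c (-φ) = O.rate c φ := by
  simp [rate, coordInv_neg, speed_neg]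

theorem rate_add_pi (c φ : ℝ) : O.rate c (φ + Real.pi) = O.rate c φ := by
  simp [rate, coordInv_neg, speed_neg]

/-- The time that the orbit of energy `c` takes from the positive `y`-axis to the angle `φ`. -/
noncomputable def clock (c φ : ℝ) : ℝ := ∫ x in (0 : ℝ)..φ, (O.rate c x)⁻¹

theorem continuous_rate_inv : Continuous fun q : ℝ × ℝ => (O.rate q.1 q.2)⁻¹ :=
  O.continuous_rate.inv₀ fun _ => (O.rate_pos _ _).ne'

theorem continuous_rate_inv_right (c : ℝ) : Continuous fun φ => (O.rate c φ)⁻¹ := by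
  simpa using O.continuous_rate_inv.comp' (Continuous.prodMk_right c)

theorem continuous_clock : Continuous fun q : ℝ × ℝ => O.clock q.1 q.2 := by
  refine intervalIntegral.continuous_parametric_intervalIntegral_of_continuous
    (f := fun (q : ℝ × ℝ) x => (O.rate q.1 x)⁻¹) ?_ continuous_snd
  have h : Continuous fun q : (ℝ × ℝ) × ℝ => (q.1.1, q.2) := by fun_prop
  simpa [Function.uncurry_def] using O.continuous_rate_inv.comp' h

theorem continuous_clock_right (c : ℝ) : Continuous (O.clock c) := by
  simpa using O.continuous_clock.comp' (Continuous.prodMk_right c)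

theorem hasDerivAt_clock (c φ : ℝ) : HasDerivAt (O.clock c) (O.rate c φ)⁻¹ φ :=
  intervalIntegral.integral_hasDerivAt_right
    ((O.continuous_rate_inv_right c).intervalIntegrable _ _)
    ((O.continuous_rate_inv_right c).stronglyMeasurableAtFilter _ _)
    (O.continuous_rate_inv_right c).continuousAt

theorem strictMono_clock (c : ℝ) : StrictMono (O.clock c) :=
  strictMono_of_deriv_pos fun φ => by
    rw [(O.hasDerivAt_clock c φ).deriv]
    exact inv_pos.2 (O.rate_pos c φ)

theorem clock_zero (c : ℝ) : O.clock c 0 = 0 := by simp [clock]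

theorem clock_neg (c φ : ℝ) : O.clock c (-φ) = -O.clock c φ := by
  have h := intervalIntegral.integral_comp_neg (a := 0) (b := φ) fun x => (O.rate c x)⁻¹
  simp only [rate_neg] at h
  unfold clock
  rw [h, neg_zero, intervalIntegral.integral_symm]

/-- By central symmetry of the orbits the angular speed has period π. -/
theorem clock_add_pi (c φ : ℝ) : O.clock c (φ + Real.pi) = O.clock c φ + O.clock c Real.pi := by
  have hI := fun a b => (O.continuous_rate_inv_right c).intervalIntegrable (μ := volume) a b
  have hper : Function.Periodic (fun x => (O.rate c x)⁻¹) Real.pi := fun x => by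
    simp [rate_add_pi]
  have h := hper.intervalIntegral_add_eq φ 0
  unfold clock
  rw [← intervalIntegral.integral_add_adjacent_intervals (hI 0 φ) (hI φ _), h, zero_add]

/-- A quarter of the period of the orbit of energy `c`. -/
noncomputable def quarter (c : ℝ) : ℝ := O.clock c (Real.pi / 2)

theorem quarter_pos (c : ℝ) : 0 < O.quarter c := by
  rw [← O.clock_zero c]
  exact O.strictMono_clock c (by positivity)

theorem clock_pi (c : ℝ) : O.clock c Real.pi = 2 * O.quarter c := by
  have h := O.clock_add_pi c (-(Real.pi / 2))
  rw [clock_neg, show -(Real.pi / 2) + Real.pi = Real.pi / 2 by ring] at h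
  unfold quarter
  linarith

theorem clock_nat_mul (c : ℝ) (k : ℕ) : O.clock c (k * (Real.pi / 2)) = k * O.quarter c := by
  -- The clock is additive only over half turns, so the induction advances by two quarters.
  induction k using Nat.twoStepInduction with
  | zero => simp [clock_zero]
  | one => simp [quarter]
  | more n ih _ =>
    have h := O.clock_add_pi c (n * (Real.pi / 2))
    rw [ih, clock_pi] at h
    push_cast
    rw [show ((n : ℝ) + 2) * (Real.pi / 2) = n * (Real.pi / 2) + Real.pi by ring, h]
    ring

theorem surjective_clock (c : ℝ) : Function.Surjective (O.clock c) := by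
  have hcont := O.continuous_clock_right c
  intro s
  obtain ⟨n, hn⟩ := exists_nat_gt (|s| / O.quarter c)
  have hn' : |s| < n * O.quarter c := (div_lt_iff₀ (O.quarter_pos c)).1 hn
  have h1 := O.clock_nat_mul c n
  have h2 := O.clock_neg c (n * (Real.pi / 2))
  have hs := abs_lt.1 hn'
  have hle : -((n : ℝ) * (Real.pi / 2)) ≤ n * (Real.pi / 2) := by
    have : 0 ≤ (n : ℝ) * (Real.pi / 2) := by positivity
    linarith
  obtain ⟨φ, -, hφ⟩ := intermediate_value_Icc hle hcont.continuousOn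
    (show s ∈ Icc _ _ from ⟨by rw [h2, h1]; exact hs.1.le, by rw [h1]; exact hs.2.le⟩)
  exact ⟨φ, hφ⟩

/-- `clock c` as an order isomorphism of the line. -/
noncomputable def clockIso (c : ℝ) : ℝ ≃o ℝ :=
  (O.strictMono_clock c).orderIsoOfSurjective _ (O.surjective_clock c)

/-- The angle at the time `s` on the orbit of energy `c` that starts on the positive `y`-axis. -/
noncomputable def angle (c s : ℝ) : ℝ := (O.clockIso c).symm s

theorem clock_angle (c s : ℝ) : O.clock c (O.angle c s) = s := (O.clockIso c).apply_symm_apply s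

theorem angle_clock (c φ : ℝ) : O.angle c (O.clock c φ) = φ := (O.clockIso c).symm_apply_apply φ

theorem strictMono_angle (c : ℝ) : StrictMono (O.angle c) := (O.clockIso c).symm.strictMono

theorem continuous_angle_right (c : ℝ) : Continuous (O.angle c) := (O.clockIso c).symm.continuous

theorem angle_lt_iff {c s φ : ℝ} : O.angle c s < φ ↔ s < O.clock c φ := by
  rw [← (O.strictMono_clock c).lt_iff_lt, clock_angle]

theorem lt_angle_iff {c s φ : ℝ} : φ < O.angle c s ↔ O.clock c φ < s := by
  rw [← (O.strictMono_clock c).lt_iff_lt, clock_angle]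

/-- An inequality between `angle c s` and a constant is one between s and a value of `clock`, hence
an open condition on (c, s), because `clock` is jointly continuous. -/
theorem continuous_angle : Continuous fun q : ℝ × ℝ => O.angle q.1 q.2 := by
  rw [continuous_iff_continuousAt]
  rintro ⟨c, s⟩
  refine tendsto_order.2 ⟨fun a ha => ?_, fun a ha => ?_⟩
  · simp only [lt_angle_iff] at ha ⊢
    have h1 : Continuous fun q : ℝ × ℝ => O.clock q.1 a :=
      O.continuous_clock.comp (by fun_prop : Continuous fun q : ℝ × ℝ => (q.1, a))
    exact (h1.continuousAt.eventually_lt continuous_snd.continuousAt ha)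
  · simp only [angle_lt_iff] at ha ⊢
    have h1 : Continuous fun q : ℝ × ℝ => O.clock q.1 a :=
      O.continuous_clock.comp (by fun_prop : Continuous fun q : ℝ × ℝ => (q.1, a))
    exact (continuous_snd.continuousAt.eventually_lt h1.continuousAt ha)

theorem hasDerivAt_angle (c s : ℝ) : HasDerivAt (O.angle c) (O.rate c (O.angle c s)) s := by
  have h := HasDerivAt.of_local_left_inverse (a := s) (O.continuous_angle_right c).continuousAt
    (O.hasDerivAt_clock c _) (inv_pos.2 (O.rate_pos _ _)).ne'
    (Eventually.of_forall (O.clock_angle c))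
  rwa [inv_inv] at h

/-- The point of energy `c` with clockwise angle `φ` from the positive `y`-axis. -/
noncomputable def point (c φ : ℝ) : ℝ × ℝ :=
  (O.coordInv (√(2 * c) * Real.sin φ), √(2 * c) * Real.cos φ)

theorem continuous_point : Continuous fun q : ℝ × ℝ => O.point q.1 q.2 := by
  have := O.continuous_coordInv
  unfold point
  fun_prop

theorem point_add_pi (c φ : ℝ) : O.point c (φ + Real.pi) = -O.point c φ := by
  simp [point, coordInv_neg]

theorem hamiltonian_point {c : ℝ} (hc : 0 ≤ c) (φ : ℝ) :
    hamiltonian O.lam O.μ O.p (O.point c φ) = c := by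
  rw [hamiltonian_eq]
  simp only [point, coord_coordInv]
  have h1 : √(2 * c) ^ 2 = 2 * c := Real.sq_sqrt (by linarith)
  have h2 := Real.sin_sq_add_cos_sq φ
  calc _ = √(2 * c) ^ 2 * (Real.sin φ ^ 2 + Real.cos φ ^ 2) / 2 := by ring
    _ = c := by rw [h1, h2]; ring

theorem hamiltonian_neg (z : ℝ × ℝ) :
    hamiltonian O.lam O.μ O.p (-z) = hamiltonian O.lam O.μ O.p z := by
  simp [hamiltonian]

theorem continuous_hamiltonian : Continuous (hamiltonian O.lam O.μ O.p) := by
  have h : hamiltonian O.lam O.μ O.p = fun z => (O.coord z.1 ^ 2 + z.2 ^ 2) / 2 :=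
    funext O.hamiltonian_eq
  have := O.continuous_coord
  rw [h]
  fun_prop

/-- With the next lemma this shows that `point c (angle c ·)` is an orbit of the hump system,
without any existence theorem for differential equations. -/
theorem hasDerivAt_point_fst (c s : ℝ) :
    HasDerivAt (fun x => (O.point c (O.angle c x)).1) (O.point c (O.angle c s)).2 s := by
  have h := (O.hasDerivAt_coordInv _).comp s (((O.hasDerivAt_angle c s).sin).const_mul (√(2 * c)))
  refine h.congr_deriv ?_
  have := (O.rate_pos c (O.angle c s)).ne'
  change (O.rate c (O.angle c s))⁻¹ * _ = _
  simp only [point]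
  field_simp

theorem hasDerivAt_point_snd (c s : ℝ) :
    HasDerivAt (fun x => (O.point c (O.angle c x)).2)
      (-(O.lam * (O.point c (O.angle c s)).1 +
        O.μ * |(O.point c (O.angle c s)).1| ^ (O.p - 1) * (O.point c (O.angle c s)).1)) s := by
  have h := ((O.hasDerivAt_angle c s).cos).const_mul (√(2 * c))
  refine h.congr_deriv ?_
  rw [← coord_mul_speed]
  simp only [point, coord_coordInv, rate]
  ring

/-- At the angle in question the abscissa is Xσ, so the factor `speed (X * σ)` from the derivative
of `coord` cancels the one in `rate`. What remains is the derivative of arcsin, and this is the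
integrand of the period. -/
theorem hasDerivAt_clock_arcsin {c X σ : ℝ} (hX : 0 < X)
    (hc : potential O.lam O.μ O.p X = c) (hσ : σ ∈ Ioo (0 : ℝ) 1) :
    HasDerivAt (fun σ => O.clock c (Real.arcsin (O.coord (X * σ) / √(2 * c))))
      (1 / √(O.lam * (1 - σ ^ 2) + 2 * O.μ / (O.p + 1) * X ^ (O.p - 1) * (1 - σ ^ (O.p + 1)))) σ := by
  obtain ⟨h0, h1⟩ := hσ
  have hp := O.p_add_one_pos
  have hXσ : 0 < X * σ := by positivity
  have hcX : O.coord X ^ 2 = 2 * c := by rw [coord_sq, abs_of_pos hX, hc]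
  have hXpos : 0 < O.coord X := by
    rw [← O.coord_zero]; exact O.strictMono_coord hX
  have hr : √(2 * c) = O.coord X := by rw [← hcX, Real.sqrt_sq hXpos.le]
  rw [hr]
  have hlt : O.coord (X * σ) < O.coord X := O.strictMono_coord (by nlinarith)
  have hpos : 0 < O.coord (X * σ) := by
    rw [← O.coord_zero]; exact O.strictMono_coord hXσ
  set w := O.coord (X * σ) / O.coord X with hw
  have hw1 : w < 1 := (div_lt_one hXpos).2 hlt
  have hw0 : 0 < w := by positivity
  have hd1 : HasDerivAt (fun σ => O.coord (X * σ) / O.coord X) (O.speed (X * σ) * X / O.coord X) σ := by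
    have := ((O.hasDerivAt_coord (X * σ)).comp σ ((hasDerivAt_id σ).const_mul X)).div_const (O.coord X)
    simpa using this
  have hd2 := (Real.hasDerivAt_arcsin (x := w) (by linarith) (by linarith)).comp σ hd1
  have hd3 := (O.hasDerivAt_clock c (Real.arcsin w)).comp σ hd2
  refine hd3.congr_deriv ?_
  have hrate : O.rate c (Real.arcsin w) = O.speed (X * σ) := by
    unfold rate
    rw [Real.sin_arcsin (by linarith) hw1.le, hr, hw, mul_div_cancel₀ _ hXpos.ne', coordInv_coord]
  rw [hrate]
  have hD : O.lam * (1 - σ ^ 2) + 2 * O.μ / (O.p + 1) * X ^ (O.p - 1) * (1 - σ ^ (O.p + 1))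
      = (O.coord X / X) ^ 2 * (1 - w ^ 2) := by
    have e1 : O.coord (X * σ) ^ 2 = O.lam * (X * σ) ^ 2 +
        2 * O.μ / (O.p + 1) * (X ^ (O.p - 1) * X ^ 2 * σ ^ (O.p + 1)) := by
      rw [coord_sq, abs_of_pos hXσ, potential, Real.mul_rpow hX.le h0.le]
      have := O.abs_rpow_sub_one_mul_sq X
      rw [abs_of_pos hX] at this
      rw [this]
      ring
    have e2 : O.coord X ^ 2 = O.lam * X ^ 2 + 2 * O.μ / (O.p + 1) * (X ^ (O.p - 1) * X ^ 2) := by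
      have := O.abs_rpow_sub_one_mul_sq X
      rw [abs_of_pos hX] at this
      rw [coord_sq, abs_of_pos hX, potential, this]
      ring
    have e3 : (O.coord X / X) ^ 2 * (1 - w ^ 2) = (O.coord X ^ 2 - O.coord (X * σ) ^ 2) / X ^ 2 := by
      rw [hw]; field_simp
    rw [e3, e1, e2]
    field_simp
    ring
  rw [hD, Real.sqrt_mul (by positivity), Real.sqrt_sq (by positivity)]
  have hs := (O.speed_pos (X * σ)).ne'
  have hq : √(1 - w ^ 2) ≠ 0 := (Real.sqrt_pos.2 (by nlinarith)).ne'
  field_simp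

theorem energyPeriod_eq {c : ℝ} (hc : 0 < c) : energyPeriod O.lam O.μ O.p c = 4 * O.quarter c := by
  obtain ⟨hX, hXc⟩ := xPlus_spec O.lam_pos O.μ_pos O.one_lt_p hc
  unfold energyPeriod orbitPeriod
  set X := xPlus O.lam O.μ O.p c
  congr 1
  have hcX : O.coord X ^ 2 = 2 * c := by rw [coord_sq, abs_of_pos hX, hXc]
  have hXpos : 0 < O.coord X := by
    rw [← O.coord_zero]; exact O.strictMono_coord hX
  have hr : √(2 * c) = O.coord X := by rw [← hcX, Real.sqrt_sq hXpos.le]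
  have hcont : ContinuousOn (fun σ => O.clock c (Real.arcsin (O.coord (X * σ) / √(2 * c))))
      (Icc 0 1) := by
    have h1 := O.continuous_clock_right c
    have h2 := O.continuous_coord
    have h3 := Real.continuous_arcsin
    exact Continuous.continuousOn (by fun_prop)
  have hderiv := fun σ (hσ : σ ∈ Ioo (0 : ℝ) 1) => O.hasDerivAt_clock_arcsin hX hXc hσ
  -- The integrand is singular at σ = 1; integrability comes from its being the nonnegative
  -- derivative of a function continuous up to the end point.
  have hint := intervalIntegral.integrableOn_deriv_of_nonneg hcont hderiv
    (fun σ _ => by positivity)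
  rw [intervalIntegral.integral_eq_sub_of_hasDerivAt_of_le zero_le_one hcont hderiv
    ((intervalIntegrable_iff_integrableOn_Ioc_of_le zero_le_one).2 hint)]
  simp [coord_zero, clock_zero, hr, div_self hXpos.ne', quarter]

end Oscillator
end MooreNehari

/-! ### Crossing paths in the plane, counting and gluing on the line -/

namespace MooreNehari

/-- Take b' as the first time at which the value u is attained, and a' as the last time before b'
with value l. -/
theorem exists_subinterval_crossing {f : ℝ → ℝ} {a b l u : ℝ} (hab : a ≤ b)
    (hf : ContinuousOn f (Icc a b)) (ha : f a ≤ l) (hlu : l < u) (hb : u ≤ f b) :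
    ∃ a' b', a ≤ a' ∧ a' < b' ∧ b' ≤ b ∧ f a' = l ∧ f b' = u ∧
      ∀ x ∈ Icc a' b', f x ∈ Icc l u := by
  have hcomp : ∀ d ≤ b, ∀ v, IsCompact {x | x ∈ Icc a d ∧ f x = v} := fun d hd v =>
    isCompact_Icc.of_isClosed_subset ((hf.mono (Icc_subset_Icc_right
      hd)).preimage_isClosed_of_isClosed isClosed_Icc isClosed_singleton) inter_subset_left
  obtain ⟨y, hy, hyu⟩ := intermediate_value_Icc hab hf
    (show u ∈ Icc (f a) (f b) from ⟨by linarith, hb⟩)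
  obtain ⟨b', ⟨hb', hb'u⟩, hmin⟩ := (hcomp b le_rfl u).exists_isLeast ⟨y, hy, hyu⟩
  have hf' := hf.mono (Icc_subset_Icc_right hb'.2)
  obtain ⟨z, hz, hzl⟩ := intermediate_value_Icc hb'.1 hf'
    (show l ∈ Icc (f a) (f b') from ⟨ha, by linarith⟩)
  obtain ⟨a', ⟨ha', ha'l⟩, hmax⟩ := (hcomp b' hb'.2 l).exists_isGreatest ⟨z, hz, hzl⟩
  have hne : a' ≠ b' := by rintro rfl; linarith
  refine ⟨a', b', ha'.1, lt_of_le_of_ne ha'.2 hne, hb'.2, ha'l, hb'u, fun x hx => ⟨?_, ?_⟩⟩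
  · by_contra! h
    obtain ⟨w, hw, hwl⟩ := intermediate_value_Icc hx.2
      (hf.mono (Icc_subset_Icc (ha'.1.trans hx.1) hb'.2))
      (show l ∈ Icc (f x) (f b') from ⟨h.le, by linarith⟩)
    have h1 : w ≤ a' := hmax ⟨⟨(ha'.1.trans hx.1).trans hw.1, hw.2⟩, hwl⟩
    have h2 : x = a' := le_antisymm (hw.1.trans h1) hx.1
    rw [h2] at h
    linarith
  · by_contra! h
    obtain ⟨w, hw, hwu⟩ := intermediate_value_Icc (ha'.1.trans hx.1)
      (hf.mono (Icc_subset_Icc_right (hx.2.trans hb'.2)))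
      (show u ∈ Icc (f a) (f x) from ⟨by linarith, h.le⟩)
    have h1 : b' ≤ w := hmin ⟨⟨hw.1, (hw.2.trans hx.2).trans hb'.2⟩, hwu⟩
    have h2 : x = b' := le_antisymm hx.2 (h1.trans hw.2)
    rw [h2] at h
    linarith

/-- A continuous angle cannot leave [0, π] without passing through values just outside, where the
sine is negative. -/
theorem mem_Icc_pi_of_sin_nonneg {θ : ℝ → ℝ} {a b : ℝ} (hθ : Continuous θ)
    (hsin : ∀ x ∈ uIcc a b, 0 ≤ Real.sin (θ x)) (ha : θ a ∈ Icc 0 Real.pi) :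
    θ b ∈ Icc 0 Real.pi := by
  have hpi := Real.pi_pos
  have key : ∀ v ∈ uIcc (θ a) (θ b), 0 ≤ Real.sin v := fun v hv => by
    obtain ⟨x, hx, rfl⟩ := intermediate_value_uIcc hθ.continuousOn hv
    exact hsin x hx
  by_contra h
  rw [mem_Icc, not_and_or, not_le, not_le] at h
  rcases h with h | h
  -- Truncation at −π/2 gives an attained value in (−π, 0), however far θ b lies below 0.
  · have h1 := key (max (θ b) (-(Real.pi / 2))) (by
      rw [uIcc_of_ge (by linarith [ha.1])]
      exact ⟨le_max_left _ _, max_le (by linarith [ha.1]) (by linarith [ha.1])⟩)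
    have h2 := Real.sin_neg_of_neg_of_neg_pi_lt (x := max (θ b) (-(Real.pi / 2)))
      (max_lt h (by linarith)) (lt_max_of_lt_right (by linarith))
    linarith
  · have h1 := key (min (θ b) (3 * Real.pi / 2)) (by
      rw [uIcc_of_le (by linarith [ha.2])]
      exact ⟨le_min (by linarith [ha.2]) (by linarith [ha.2]), min_le_left _ _⟩)
    have h2 := Real.sin_pos_of_pos_of_lt_pi (x := min (θ b) (3 * Real.pi / 2) - Real.pi)
      (by linarith [lt_min h (by linarith : Real.pi < 3 * Real.pi / 2)])
      (by linarith [min_le_right (θ b) (3 * Real.pi / 2)])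
    rw [Real.sin_sub_pi] at h2
    linarith

/-- If the paths never met, their difference, as a complex function of (s, t), would have a global
logarithm, because exp is a covering and the plane is simply connected. The side conditions confine
the difference to one half-plane along each side of the rectangle. Following the argument around the
boundary would then lower it by a full turn, although it is single-valued. -/
theorem exists_crossing_of_continuous {f₁ f₂ g₁ g₂ : ℝ → ℝ} {a b a' b' : ℝ}
    (hf₁ : Continuous f₁) (hf₂ : Continuous f₂) (hg₁ : Continuous g₁) (hg₂ : Continuous g₂)
    (hleft : ∀ t, f₁ a ≤ g₁ t) (hright : ∀ t, g₁ t ≤ f₁ b)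
    (hbot : ∀ s, g₂ a' ≤ f₂ s) (htop : ∀ s, f₂ s ≤ g₂ b') :
    ∃ s t, f₁ s = g₁ t ∧ f₂ s = g₂ t := by
  by_contra! hne
  have hpi := Real.pi_pos
  let F : C(ℝ × ℝ, ℂ) := ⟨fun q => ⟨f₁ q.1 - g₁ q.2, f₂ q.1 - g₂ q.2⟩, by
    have : (fun q : ℝ × ℝ => (⟨f₁ q.1 - g₁ q.2, f₂ q.1 - g₂ q.2⟩ : ℂ)) = fun q =>
        ((f₁ q.1 - g₁ q.2 : ℝ) : ℂ) + ((f₂ q.1 - g₂ q.2 : ℝ) : ℂ) * Complex.I := by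
      funext q
      apply Complex.ext <;> simp
    rw [this]
    fun_prop⟩
  have hF : ∀ q, F q ≠ 0 := fun q h => by
    have h1 : f₁ q.1 - g₁ q.2 = 0 := congrArg Complex.re h
    have h2 : f₂ q.1 - g₂ q.2 = 0 := congrArg Complex.im h
    exact hne q.1 q.2 (sub_eq_zero.1 h1) (sub_eq_zero.1 h2)
  obtain ⟨G, ⟨hG0, hG⟩, -⟩ := Complex.isCoveringMapOn_exp.existsUnique_continuousMap_lifts F
    (a₀ := (a, a')) (Complex.exp_log (hF (a, a'))) (fun q => hF q)
  set θ : ℝ × ℝ → ℝ := fun q => (G q).im with hθdef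
  have hθ : Continuous θ := Complex.continuous_im.comp G.continuous
  have hre : ∀ q : ℝ × ℝ, f₁ q.1 - g₁ q.2 = Real.exp (G q).re * Real.cos (θ q) := fun q => by
    rw [← Complex.exp_re]
    exact congrArg Complex.re (congrFun hG q).symm
  have him : ∀ q : ℝ × ℝ, f₂ q.1 - g₂ q.2 = Real.exp (G q).re * Real.sin (θ q) := fun q => by
    rw [← Complex.exp_im]
    exact congrArg Complex.im (congrFun hG q).symm
  have hcL : ∀ t, Real.cos (θ (a, t)) ≤ 0 := fun t => by
    have h := hre (a, t)
    have h2 := hleft t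
    by_contra! h3
    have := mul_pos (Real.exp_pos (G (a, t)).re) h3
    simp only at h
    linarith
  have hcR : ∀ t, 0 ≤ Real.cos (θ (b, t)) := fun t => by
    have h := hre (b, t)
    have h2 := hright t
    by_contra! h3
    have := mul_neg_of_pos_of_neg (Real.exp_pos (G (b, t)).re) h3
    simp only at h
    linarith
  have hsB : ∀ s, 0 ≤ Real.sin (θ (s, a')) := fun s => by
    have h := him (s, a')
    have h2 := hbot s
    by_contra! h3
    have := mul_neg_of_pos_of_neg (Real.exp_pos (G (s, a')).re) h3
    simp only at h
    linarith
  have hsT : ∀ s, Real.sin (θ (s, b')) ≤ 0 := fun s => by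
    have h := him (s, b')
    have h2 := htop s
    by_contra! h3
    have := mul_pos (Real.exp_pos (G (s, b')).re) h3
    simp only at h
    linarith
  have e0 : θ (a, a') ∈ Icc (Real.pi / 2) Real.pi := by
    have h1 : θ (a, a') = Complex.arg (F (a, a')) := by rw [hθdef]; simp only [hG0, Complex.log_im]
    have h2 : θ (a, a') ≤ Real.pi := h1 ▸ Complex.arg_le_pi _
    have h3 : 0 ≤ θ (a, a') := by
      rw [h1, Complex.arg_nonneg_iff]
      exact sub_nonneg.2 (hbot a)
    refine ⟨?_, h2⟩
    by_contra! h4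
    have := Real.cos_pos_of_mem_Ioo (x := θ (a, a')) ⟨by linarith, h4⟩
    linarith [hcL a']
  have e1 : θ (b, a') ∈ Icc 0 (Real.pi / 2) := by
    have h := mem_Icc_pi_of_sin_nonneg (θ := fun s => θ (s, a')) (a := a) (b := b) (by fun_prop)
      (fun s _ => hsB s) ⟨by linarith [e0.1], e0.2⟩
    refine ⟨h.1, ?_⟩
    by_contra! h4
    have := Real.cos_neg_of_pi_div_two_lt_of_lt h4 (by linarith [h.2])
    linarith [hcR a']
  have e2 : θ (b, b') ∈ Icc (-(Real.pi / 2)) 0 := by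
    have h := mem_Icc_pi_of_sin_nonneg (θ := fun t => θ (b, t) + Real.pi / 2) (a := a') (b := b')
      (by fun_prop) (fun t _ => by rw [Real.sin_add_pi_div_two]; exact hcR t)
      ⟨by linarith [e1.1], by linarith [e1.2]⟩
    refine ⟨by linarith [h.1], ?_⟩
    by_contra! h4
    have := Real.sin_pos_of_pos_of_lt_pi h4 (by linarith [h.2])
    linarith [hsT b]
  have e3 : θ (a, b') ∈ Icc (-Real.pi) (-(Real.pi / 2)) := by
    have h := mem_Icc_pi_of_sin_nonneg (θ := fun s => θ (s, b') + Real.pi) (a := b) (b := a)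
      (by fun_prop) (fun s _ => by rw [Real.sin_add_pi]; linarith [hsT s])
      ⟨by linarith [e2.1], by linarith [e2.2]⟩
    refine ⟨by linarith [h.1], ?_⟩
    by_contra! h4
    have := Real.cos_pos_of_mem_Ioo (x := θ (a, b')) ⟨h4, by linarith [h.2]⟩
    linarith [hcL b']
  have e4 := mem_Icc_pi_of_sin_nonneg (θ := fun t => θ (a, t) + Real.pi / 2 + Real.pi) (a := b') (b := a')
      (by fun_prop) (fun t _ => by
        rw [Real.sin_add_pi, Real.sin_add_pi_div_two]; linarith [hcL t])
      ⟨by linarith [e3.1], by linarith [e3.2]⟩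
  linarith [e4.2, e0.1]

/-- Two paths in a rectangle, one joining the vertical and one the horizontal sides, meet. -/
theorem exists_crossing {f₁ f₂ g₁ g₂ : ℝ → ℝ} {a b a' b' : ℝ} (hab : a ≤ b) (hab' : a' ≤ b')
    (hf₁ : ContinuousOn f₁ (Icc a b)) (hf₂ : ContinuousOn f₂ (Icc a b))
    (hg₁ : ContinuousOn g₁ (Icc a' b')) (hg₂ : ContinuousOn g₂ (Icc a' b'))
    (hleft : ∀ t ∈ Icc a' b', f₁ a ≤ g₁ t) (hright : ∀ t ∈ Icc a' b', g₁ t ≤ f₁ b)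
    (hbot : ∀ s ∈ Icc a b, g₂ a' ≤ f₂ s) (htop : ∀ s ∈ Icc a b, f₂ s ≤ g₂ b') :
    ∃ s ∈ Icc a b, ∃ t ∈ Icc a' b', f₁ s = g₁ t ∧ f₂ s = g₂ t := by
  -- The paths are extended to the whole line as constants, by clamping the parameter.
  have hc : ∀ c d : ℝ, Continuous fun x : ℝ => max c (min x d) := fun c d => by fun_prop
  have hm : ∀ {c d : ℝ}, c ≤ d → ∀ x, max c (min x d) ∈ Icc c d := fun h x =>
    ⟨le_max_left _ _, max_le h (min_le_right _ _)⟩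
  have hL : ∀ {c d : ℝ}, c ≤ d → max c (min c d) = c := fun h => by simp [h]
  have hR : ∀ {c d : ℝ}, c ≤ d → max c (min d d) = d := fun h => by simp [h]
  obtain ⟨s, t, h1, h2⟩ := exists_crossing_of_continuous (a := a) (b := b) (a' := a') (b' := b')
    (hf₁.comp_continuous (hc a b) (hm hab)) (hf₂.comp_continuous (hc a b) (hm hab))
    (hg₁.comp_continuous (hc a' b') (hm hab')) (hg₂.comp_continuous (hc a' b') (hm hab'))
    (fun t => by show f₁ (max a (min a b)) ≤ _; rw [hL hab]; exact hleft _ (hm hab' t))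
    (fun t => by show _ ≤ f₁ (max a (min b b)); rw [hR hab]; exact hright _ (hm hab' t))
    (fun s => by show g₂ (max a' (min a' b')) ≤ _; rw [hL hab']; exact hbot _ (hm hab s))
    (fun s => by show _ ≤ g₂ (max a' (min b' b')); rw [hR hab']; exact htop _ (hm hab s))
  exact ⟨_, hm hab s, _, hm hab' t, h1, h2⟩

theorem encard_eq_of_strictMonoOn {f : ℝ → ℝ} {a b : ℝ} {Z : Set ℝ} {N : ℕ} {v : ℕ → ℝ}
    (hab : a ≤ b) (hf : StrictMonoOn f (Icc a b)) (hc : ContinuousOn f (Icc a b))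
    (hv : Function.Injective v) (hvN : ∀ k < N, v k ∈ Icc (f a) (f b)) (hZ : Z ⊆ Icc a b)
    (hiff : ∀ x ∈ Icc a b, x ∈ Z ↔ ∃ k < N, f x = v k) : Z.encard = N := by
  have himg : f '' Z = v '' Iio N := by
    ext y
    constructor
    · rintro ⟨x, hx, rfl⟩
      obtain ⟨k, hk, h⟩ := (hiff x (hZ hx)).1 hx
      exact ⟨k, hk, h.symm⟩
    · rintro ⟨k, hk, rfl⟩
      obtain ⟨x, hx, h⟩ := intermediate_value_Icc hab hc (hvN k hk)
      exact ⟨x, (hiff x hx).2 ⟨k, hk, h⟩, h⟩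
  rw [← (hf.injOn.mono hZ).encard_image, himg, hv.encard_image]
  have : (Iio N : Set ℕ) = (Finset.range N : Set ℕ) := by ext; simp
  rw [this, Set.encard_coe_eq_coe_finsetCard, Finset.card_range]

theorem sin_eq_zero_iff_exists_nat {y : ℝ} {k₀ : ℤ} {N : ℕ} (h₀ : (k₀ - 1) * Real.pi < y)
    (h₁ : y < (k₀ + N) * Real.pi) :
    Real.sin y = 0 ↔ ∃ k < N, y = (k₀ + k) * Real.pi := by
  constructor
  · intro h
    obtain ⟨n, rfl⟩ := Real.sin_eq_zero_iff.1 h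
    have h0 := lt_of_mul_lt_mul_right h₀ Real.pi_pos.le
    have h1 := lt_of_mul_lt_mul_right h₁ Real.pi_pos.le
    have h0' : k₀ - 1 < n := by exact_mod_cast h0
    have h1' : n < k₀ + N := by exact_mod_cast h1
    refine ⟨(n - k₀).toNat, by omega, ?_⟩
    have h2 : ((n - k₀).toNat : ℤ) = n - k₀ := Int.toNat_of_nonneg (by omega)
    have h3 : (((n - k₀).toNat : ℕ) : ℝ) = n - k₀ := by exact_mod_cast h2
    rw [h3]
    ring
  · rintro ⟨k, -, rfl⟩
    have := Real.sin_int_mul_pi (k₀ + k)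
    push_cast at this
    exact this

theorem exists_glue {b : ℕ → ℝ} (hb : StrictMono b) {X : Type*} (F : ℕ → ℝ → X) (K : ℕ)
    (hF : ∀ k < K, F k (b (k + 1)) = F (k + 1) (b (k + 1))) :
    ∃ f : ℝ → X, ∀ k ≤ K, EqOn f (F k) (Icc (b k) (b (k + 1))) := by
  induction K with
  | zero =>
    refine ⟨F 0, fun k hk => ?_⟩
    obtain rfl := Nat.le_zero.1 hk
    exact fun _ _ => rfl
  | succ K ih =>
    obtain ⟨f, hf⟩ := ih fun k hk => hF k (hk.trans (Nat.lt_succ_self K))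
    refine ⟨fun x => if x ≤ b (K + 1) then f x else F (K + 1) x, fun k hk x hx => ?_⟩
    rcases Nat.lt_or_eq_of_le hk with h | rfl
    · have h1 : k + 1 ≤ K + 1 := h
      have h2 := hx.2.trans (hb.monotone h1)
      simp only [if_pos h2]
      exact hf k (by omega) hx
    · rcases hx.1.eq_or_lt with rfl | h
      · simp only [le_refl, if_true]
        rw [hf K le_rfl ⟨(hb (Nat.lt_succ_self K)).le, le_rfl⟩]
        exact hF K (Nat.lt_succ_self K)
      · simp only [if_neg (not_le.2 h)]

end MooreNehari

/-! ### From a piecewise orbit to a Carathéodory solution -/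

namespace MooreNehari

theorem AbsolutelyContinuousOnInterval.congr {f g : ℝ → ℝ} {a b : ℝ}
    (hf : AbsolutelyContinuousOnInterval f a b) (h : EqOn f g (uIcc a b)) :
    AbsolutelyContinuousOnInterval g a b := by
  rw [absolutelyContinuousOnInterval_iff] at hf ⊢
  intro ε hε
  obtain ⟨δ, hδ, H⟩ := hf ε hε
  refine ⟨δ, hδ, fun E hE hlen => ?_⟩
  convert H E hE hlen using 1
  refine Finset.sum_congr rfl fun i hi => ?_
  rw [h (hE.1 i hi).1, h (hE.1 i hi).2]

/-- A continuous pair satisfying the first order system off a countable set is a solution. -/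
theorem isSolution_of_hasDerivAt {lam p L : ℝ} {a u v : ℝ → ℝ} {r₀ r_L : Set (ℝ × ℝ)} {E : Set ℝ}
    (hL : 0 < L) (hp : 1 < p) (hE : E.Countable) (ha : IntervalIntegrable a volume 0 L)
    (hu : ContinuousOn u (Icc 0 L)) (hv : ContinuousOn v (Icc 0 L))
    (hud : ∀ x ∈ Ioo 0 L \ E, HasDerivAt u (v x) x)
    (hvd : ∀ x ∈ Ioo 0 L \ E, HasDerivAt v (-(lam * u x + a x * |u x| ^ (p - 1) * u x)) x)
    (h₀ : (u 0, v 0) ∈ r₀) (h_L : (u L, v L) ∈ r_L) :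
    IsSolution lam p L a r₀ r_L u ∧ ∀ x ∈ Icc 0 L, slope L u x = v x := by
  have huIcc : uIcc 0 L = Icc 0 L := uIcc_of_le hL.le
  -- Clamping makes v continuous on the line; its primitive W is then C¹ and agrees with u on [0,
  -- L], which gives u' = v also at the exceptional points and at both ends.
  set w : ℝ → ℝ := fun x => v (max 0 (min x L)) with hw
  have hwc : Continuous w := hv.comp_continuous (by fun_prop)
    fun x => ⟨le_max_left _ _, max_le hL.le (min_le_right _ _)⟩
  have hwv : ∀ x ∈ Icc 0 L, w x = v x := fun x hx => by simp [hw, hx.1, hx.2]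
  have hint : ∀ {f f' : ℝ → ℝ} {x : ℝ}, x ∈ Icc 0 L → ContinuousOn f (Icc 0 L) →
      (∀ x ∈ Ioo 0 L \ E, HasDerivAt f (f' x) x) → IntervalIntegrable f' volume 0 L →
      ∫ y in (0 : ℝ)..x, f' y = f x - f 0 := fun {f f' x} hx hf hf' hi => by
    refine integral_eq_of_hasDerivAt_off_countable_of_le f f' hx.1 hE
      (hf.mono (Icc_subset_Icc_right hx.2))
      (fun y hy => hf' y ⟨⟨hy.1.1, hy.1.2.trans_le hx.2⟩, hy.2⟩)
      (hi.mono_set ?_)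
    rw [huIcc, uIcc_of_le hx.1]
    exact Icc_subset_Icc_right hx.2
  set W : ℝ → ℝ := fun x => u 0 + ∫ y in (0 : ℝ)..x, w y with hW
  have hWd : ∀ x, HasDerivAt W (w x) x := fun x =>
    (intervalIntegral.integral_hasDerivAt_right (hwc.intervalIntegrable _ _)
      (hwc.stronglyMeasurableAtFilter _ _) hwc.continuousAt).const_add _
  have hWu : EqOn u W (Icc 0 L) := fun x hx => by
    have h := hint (f' := w) hx hu
      (fun y hy => by rw [hwv y (Ioo_subset_Icc_self hy.1)]; exact hud y hy)
      (hwc.intervalIntegrable _ _)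
    simp only [hW, h]
    ring
  have hslope : ∀ x ∈ Icc 0 L, slope L u x = v x := fun x hx => by
    have h := ((hWd x).hasDerivWithinAt (s := Icc 0 L)).congr hWu (hWu hx)
    rw [← hwv x hx]
    exact h.derivWithin (uniqueDiffOn_Icc hL x hx)
  have hFi : IntervalIntegrable (fun x => -(lam * u x + a x * |u x| ^ (p - 1) * u x))
      volume 0 L := by
    have h1 : ContinuousOn (fun x => |u x| ^ (p - 1) * u x) (uIcc 0 L) := by
      rw [huIcc]
      exact ((hu.abs).rpow_const fun x _ => Or.inr (by linarith)).mul hu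
    have h2 : ContinuousOn (fun x => lam * u x) (uIcc 0 L) := by
      rw [huIcc]
      exact hu.const_mul lam
    have h3 := (h2.intervalIntegrable.add (ha.mul_continuousOn h1)).neg
    simpa only [Pi.add_apply, Pi.neg_def, Pi.add_def, mul_assoc] using h3
  refine ⟨⟨?_, ?_, ?_, ?_, ?_⟩, hslope⟩
  · have hdW : deriv W = w := funext fun x => (hWd x).deriv
    have : ContDiff ℝ 1 W := contDiff_one_iff_deriv.2
      ⟨fun x => (hWd x).differentiableAt, by rw [hdW]; exact hwc⟩
    exact this.contDiffOn.congr hWu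
  -- The slope is v 0 plus the integral of an integrable function.
  · have h1 := hFi.absolutelyContinuousOnInterval_intervalIntegral (c := 0) left_mem_uIcc
    have h2 : AbsolutelyContinuousOnInterval (fun _ : ℝ => v 0) 0 L :=
      (LipschitzWith.const (v 0)).lipschitzOnWith.absolutelyContinuousOnInterval
    refine AbsolutelyContinuousOnInterval.congr (h2.add h1) fun x hx => ?_
    rw [huIcc] at hx
    rw [hslope x hx, Pi.add_apply, hint hx hv hvd hFi]
    ring
  · filter_upwards [hE.ae_notMem volume] with x hx hx'
    refine (hvd x ⟨hx', hx⟩).congr_of_eventuallyEq ?_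
    filter_upwards [Ioo_mem_nhds hx'.1 hx'.2] with y hy
    exact hslope y (Ioo_subset_Icc_self hy)
  · rw [phase, hslope 0 ⟨le_rfl, hL.le⟩]; exact h₀
  · rw [phase, hslope L ⟨hL.le, le_rfl⟩]; exact h_L

/-! ### The boundary arcs as paths in the energy-angle strip -/

/-- The sign of the `x`-coordinate in a block. -/
def Block.sign : Block → ℝ
  | .I => 1
  | .III => -1

theorem Block.sign_eq_one_or (b : Block) : b.sign = 1 ∨ b.sign = -1 := by
  cases b <;> simp [Block.sign]

/-- The clockwise angle, in quarter turns, at which the quadrant starts inside its half-plane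
`x ≥ 0` or `x ≤ 0`. -/
def Quadrant.shift : Quadrant → ℕ
  | .I => 0
  | .II => 1
  | .III => 0
  | .IV => 1

/-- A path in the strip `[c₁, c₂] × ℝ` that joins its two sides and runs in `S`. -/
def HasCrossing (c₁ c₂ : ℝ) (S : Set (ℝ × ℝ)) : Prop :=
  ∃ (a b : ℝ) (c φ : ℝ → ℝ), a < b ∧ ContinuousOn c (Icc a b) ∧ ContinuousOn φ (Icc a b) ∧
    c a = c₁ ∧ c b = c₂ ∧ ∀ r ∈ Icc a b, c r ∈ Icc c₁ c₂ ∧ (c r, φ r) ∈ S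

namespace Oscillator

variable (O : Oscillator)

theorem hamiltonian_smul {ε : ℝ} (hε : ε = 1 ∨ ε = -1) (z : ℝ × ℝ) :
    hamiltonian O.lam O.μ O.p (ε • z) = hamiltonian O.lam O.μ O.p z := by
  rcases hε with rfl | rfl
  · rw [one_smul]
  · rw [neg_one_smul, hamiltonian_neg]

theorem coord_sq_add_sq (z : ℝ × ℝ) :
    O.coord z.1 ^ 2 + z.2 ^ 2 = 2 * hamiltonian O.lam O.μ O.p z := by
  rw [hamiltonian_eq]; ring

/-- The angle in `[-π/2, π/2]` of a point of the upper half-plane. -/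
noncomputable def upperAngle (z : ℝ × ℝ) : ℝ :=
  Real.arcsin (O.coord z.1 / √(2 * hamiltonian O.lam O.μ O.p z))

theorem point_upperAngle {z : ℝ × ℝ} (hz : 0 < hamiltonian O.lam O.μ O.p z) (h2 : 0 ≤ z.2) :
    O.point (hamiltonian O.lam O.μ O.p z) (O.upperAngle z) = z := by
  set c := hamiltonian O.lam O.μ O.p z with hc
  have hs : 0 < √(2 * c) := Real.sqrt_pos.2 (by linarith)
  have hs2 : √(2 * c) ^ 2 = 2 * c := Real.sq_sqrt (by linarith)
  have h := O.coord_sq_add_sq z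
  rw [← hc] at h
  have hle : |O.coord z.1 / √(2 * c)| ≤ 1 := by
    rw [abs_div, abs_of_pos hs, div_le_one hs]
    apply abs_le_of_sq_le_sq _ hs.le
    nlinarith [sq_nonneg z.2]
  have hle' := abs_le.1 hle
  apply Prod.ext
  · simp only [point, upperAngle, ← hc]
    rw [Real.sin_arcsin hle'.1 hle'.2, mul_div_cancel₀ _ hs.ne', coordInv_coord]
  · simp only [point, upperAngle, ← hc]
    rw [Real.cos_arcsin]
    have : 1 - (O.coord z.1 / √(2 * c)) ^ 2 = (z.2 / √(2 * c)) ^ 2 := by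
      field_simp
      rw [hs2]
      linarith
    rw [this, Real.sqrt_sq (by positivity), mul_div_cancel₀ _ hs.ne']

theorem continuousOn_upperAngle :
    ContinuousOn O.upperAngle {z | 0 < hamiltonian O.lam O.μ O.p z} := by
  have h1 := O.continuous_hamiltonian
  have h2 := O.continuous_coord
  refine Real.continuous_arcsin.comp_continuousOn (ContinuousOn.div ?_ ?_ fun z hz => ?_)
  · exact (h2.comp continuous_fst).continuousOn
  · exact Continuous.continuousOn (by fun_prop)
  · have hz : 0 < hamiltonian O.lam O.μ O.p z := hz
    exact (Real.sqrt_pos.2 (by linarith)).ne'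

theorem upperAngle_nonneg {z : ℝ × ℝ} (h : 0 ≤ z.1) : 0 ≤ O.upperAngle z := by
  apply Real.arcsin_nonneg.2
  have : 0 ≤ O.coord z.1 := by
    rw [← O.coord_zero]; exact O.strictMono_coord.monotone h
  positivity

theorem upperAngle_nonpos {z : ℝ × ℝ} (h : z.1 ≤ 0) : O.upperAngle z ≤ 0 := by
  apply Real.arcsin_nonpos.2
  have : O.coord z.1 ≤ 0 := by
    rw [← O.coord_zero]; exact O.strictMono_coord.monotone h
  exact div_nonpos_of_nonpos_of_nonneg this (Real.sqrt_nonneg _)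

/-- After the central symmetry for x ≤ 0 all angles lie in [0, π]. `upperAngle` applies directly in
the upper half-plane and through z ↦ −z in the lower one; quadrants II and IV need an additional π,
which changes the sign of the point. -/
theorem exists_quadrant_angle (q : Quadrant) :
    ∃ f : ℝ × ℝ → ℝ, ContinuousOn f {z | 0 < hamiltonian O.lam O.μ O.p z} ∧
      ∀ z ∈ q.region, 0 < hamiltonian O.lam O.μ O.p z →
        f z ∈ Icc (q.shift * (Real.pi / 2)) ((q.shift + 1) * (Real.pi / 2)) ∧
        q.sameSide.sign • O.point (hamiltonian O.lam O.μ O.p z) (f z) = z := by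
  have hneg : ContinuousOn (fun z => O.upperAngle (-z)) {z | 0 < hamiltonian O.lam O.μ O.p z} :=
    O.continuousOn_upperAngle.comp continuous_neg.continuousOn fun z hz => by
      simpa [hamiltonian_neg] using hz
  have hpt : ∀ z : ℝ × ℝ, 0 < hamiltonian O.lam O.μ O.p z → z.2 ≤ 0 →
      O.point (hamiltonian O.lam O.μ O.p z) (O.upperAngle (-z)) = -z := fun z hz h2 => by
    have h := O.point_upperAngle (z := -z) (by rwa [hamiltonian_neg]) (by simpa using h2)
    rwa [hamiltonian_neg] at h
  have hup : ∀ z, O.upperAngle z ≤ Real.pi / 2 := fun z => Real.arcsin_le_pi_div_two _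
  have hlo : ∀ z, -(Real.pi / 2) ≤ O.upperAngle z := fun z => Real.neg_pi_div_two_le_arcsin _
  cases q
  · refine ⟨O.upperAngle, O.continuousOn_upperAngle, fun z hz h => ⟨⟨?_, ?_⟩, ?_⟩⟩
    · simpa [Quadrant.shift] using O.upperAngle_nonneg hz.1
    · simpa [Quadrant.shift] using hup z
    · simpa [Quadrant.sameSide, Block.sign] using O.point_upperAngle h hz.2
  · refine ⟨fun z => O.upperAngle z + Real.pi, O.continuousOn_upperAngle.add continuousOn_const,
      fun z hz h => ⟨⟨?_, ?_⟩, ?_⟩⟩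
    · simp only [Quadrant.shift]
      push_cast
      linarith [hlo z]
    · simp only [Quadrant.shift]
      push_cast
      linarith [O.upperAngle_nonpos hz.1]
    · simp [Quadrant.sameSide, Block.sign, point_add_pi, O.point_upperAngle h hz.2]
  · refine ⟨fun z => O.upperAngle (-z), hneg, fun z hz h => ⟨⟨?_, ?_⟩, ?_⟩⟩
    · simpa [Quadrant.shift] using O.upperAngle_nonneg (z := -z) (by simpa using hz.1)
    · simpa [Quadrant.shift] using hup (-z)
    · simp [Quadrant.sameSide, Block.sign, hpt z h hz.2]
  · refine ⟨fun z => O.upperAngle (-z) + Real.pi, hneg.add continuousOn_const,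
      fun z hz h => ⟨⟨?_, ?_⟩, ?_⟩⟩
    · simp only [Quadrant.shift]
      push_cast
      linarith [hlo (-z)]
    · simp only [Quadrant.shift]
      push_cast
      linarith [O.upperAngle_nonpos (z := -z) (by simpa using hz.1)]
    · simp [Quadrant.sameSide, Block.sign, point_add_pi, hpt z h hz.2]

/-- The energy vanishes at the origin and its sublevel sets are compact, so along the arc it passes
from 0 to values above c₂. -/
theorem hasCrossing_of_isUnboundedArc {r : Set (ℝ × ℝ)} {q : Quadrant} {c₁ c₂ : ℝ}
    (hr : IsUnboundedArc r) (hq : r ⊆ q.region) (hc₁ : 0 < c₁) (hc : c₁ < c₂) :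
    HasCrossing c₁ c₂ {z | z.2 ∈ Icc (q.shift * (Real.pi / 2)) ((q.shift + 1) * (Real.pi / 2)) ∧
      q.sameSide.sign • O.point z.1 z.2 ∈ r} := by
  obtain ⟨γ, hγ, -, hγ0, hlim, rfl⟩ := hr
  obtain ⟨f, hf, hfz⟩ := O.exists_quadrant_angle q
  set H := hamiltonian O.lam O.μ O.p with hH
  have hHc : Continuous H := O.continuous_hamiltonian
  have hbdd : Bornology.IsBounded {z | H z ≤ c₂} := by
    have hl := O.lam_pos
    refine (Metric.isBounded_closedBall (x := (0 : ℝ × ℝ))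
      (r := max √(2 * c₂ / O.lam) √(2 * c₂))).subset fun z hz => ?_
    have hz : H z ≤ c₂ := hz
    have h1 : 0 ≤ O.μ / (O.p + 1) * |z.1| ^ (O.p + 1) := by
      have := O.μ_pos; have := O.p_add_one_pos; positivity
    have h2 : 1 / 2 * z.2 ^ 2 + (O.lam / 2 * |z.1| ^ 2 + O.μ / (O.p + 1) * |z.1| ^ (O.p + 1)) ≤ c₂ := hz
    rw [sq_abs] at h2
    rw [mem_closedBall_zero_iff, Prod.norm_def]
    refine max_le_max ?_ ?_
    · rw [Real.norm_eq_abs]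
      apply Real.abs_le_sqrt
      rw [le_div_iff₀ hl]
      nlinarith [sq_nonneg z.2]
    · rw [Real.norm_eq_abs]
      apply Real.abs_le_sqrt
      nlinarith [sq_nonneg z.1]
  have hev : ∀ᶠ s in atTop, c₂ < H (γ s) := by
    have h1 : {z | H z ≤ c₂}ᶜ ∈ cocompact (ℝ × ℝ) := by
      refine IsCompact.compl_mem_cocompact ?_
      exact Metric.isCompact_of_isClosed_isBounded (isClosed_le hHc continuous_const) hbdd
    filter_upwards [hlim h1] with s hs
    simpa using hs
  obtain ⟨T, hT, hT0⟩ := (hev.and (eventually_ge_atTop 0)).exists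
  have hγT : ContinuousOn γ (Icc 0 T) := hγ.mono Icc_subset_Ici_self
  have h0 : H (γ 0) ≤ c₁ := by
    rw [hγ0, hH, hamiltonian_eq]
    simpa [coord_zero] using hc₁.le
  obtain ⟨a, b, ha, hab, hb, hca, hcb, hmem⟩ := exists_subinterval_crossing hT0
    (hHc.comp_continuousOn hγT) h0 hc hT.le
  have hγab : ContinuousOn γ (Icc a b) := hγT.mono (Icc_subset_Icc ha hb)
  have hpos : ∀ s ∈ Icc a b, 0 < H (γ s) := fun s hs => hc₁.trans_le (hmem s hs).1
  have hin : ∀ s ∈ Icc a b, γ s ∈ γ '' Ici 0 := fun s hs => ⟨s, ha.trans hs.1, rfl⟩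
  refine ⟨a, b, H ∘ γ, f ∘ γ, hab, hHc.comp_continuousOn hγab, hf.comp hγab hpos, hca, hcb,
    fun s hs => ⟨hmem s hs, ?_⟩⟩
  have h := hfz (γ s) (hq (hin s hs)) (hpos s hs)
  refine ⟨h.1, ?_⟩
  simp only [Function.comp]
  rw [h.2]
  exact hin s hs

/-! ### Rotation and stretching on a hump -/

/-- The angle at the time `τ` on the orbit of energy `c` that starts at the angle `φ`. -/
noncomputable def rot (τ c φ : ℝ) : ℝ := O.angle c (O.clock c φ + τ)

theorem continuous_rot (τ : ℝ) : Continuous fun q : ℝ × ℝ => O.rot τ q.1 q.2 := by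
  have h : Continuous fun q : ℝ × ℝ => (q.1, O.clock q.1 q.2 + τ) :=
    continuous_fst.prodMk (O.continuous_clock.add continuous_const)
  simpa [rot] using O.continuous_angle.comp' h

theorem continuousOn_rot (τ : ℝ) {c φ : ℝ → ℝ} {s : Set ℝ} (hc : ContinuousOn c s)
    (hφ : ContinuousOn φ s) : ContinuousOn (fun r => O.rot τ (c r) (φ r)) s := by
  simpa only [Function.comp_def] using (O.continuous_rot τ).comp_continuousOn (hc.prodMk hφ)

theorem rot_lt {τ c φ : ℝ} {n k : ℕ} (hτ : τ < k * O.quarter c) (hφ : φ ≤ n * (Real.pi / 2)) :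
    O.rot τ c φ < ((n + k : ℕ) : ℝ) * (Real.pi / 2) := by
  have h := (O.strictMono_clock c).monotone hφ
  rw [clock_nat_mul] at h
  rw [rot, angle_lt_iff, clock_nat_mul]
  push_cast
  linarith

theorem lt_rot {τ c φ : ℝ} {n k : ℕ} (hτ : k * O.quarter c < τ) (hφ : n * (Real.pi / 2) ≤ φ) :
    ((n + k : ℕ) : ℝ) * (Real.pi / 2) < O.rot τ c φ := by
  have h := (O.strictMono_clock c).monotone hφ
  rw [clock_nat_mul] at h
  rw [rot, lt_angle_iff, clock_nat_mul]
  push_cast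
  linarith

/-- The twist of a hump stretches a path that crosses the annulus in a quadrant across the sector
between `l` and `l + 1` quarter turns. -/
theorem exists_subinterval_rot {τ c₁ c₂ a b : ℝ} {c φ : ℝ → ℝ} {d k₁ k₂ l : ℕ}
    (hab : a < b) (hc : ContinuousOn c (Icc a b)) (hφ : ContinuousOn φ (Icc a b))
    (hca : c a = c₁) (hcb : c b = c₂)
    (hd : ∀ r ∈ Icc a b, φ r ∈ Icc (d * (Real.pi / 2)) ((d + 1) * (Real.pi / 2)))
    (h₁ : τ < k₁ * O.quarter c₁) (h₂ : k₂ * O.quarter c₂ < τ)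
    (hl : d + 1 + k₁ ≤ l) (hu : l + 1 ≤ d + k₂) :
    ∃ a' b', a ≤ a' ∧ a' < b' ∧ b' ≤ b ∧ O.rot τ (c a') (φ a') = l * (Real.pi / 2) ∧
      O.rot τ (c b') (φ b') = (l + 1) * (Real.pi / 2) ∧
      ∀ r ∈ Icc a' b', O.rot τ (c r) (φ r) ∈ Icc (l * (Real.pi / 2)) ((l + 1) * (Real.pi / 2)) := by
  have hpi := Real.pi_pos
  refine exists_subinterval_crossing (f := fun r => O.rot τ (c r) (φ r)) hab.le
    (O.continuousOn_rot τ hc hφ) ?_ (by linarith) ?_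
  -- On the slow boundary the orbit starts before the quarter d + 1 and makes fewer than k₁ quarter
  -- turns; on the fast boundary it starts after the quarter d and makes more than k₂.
  · rw [hca]
    have h := O.rot_lt (n := d + 1) h₁ (by push_cast; exact (hd a ⟨le_rfl, hab.le⟩).2)
    refine h.le.trans ?_
    have : ((d + 1 + k₁ : ℕ) : ℝ) ≤ l := by exact_mod_cast hl
    nlinarith
  · rw [hcb]
    have h := O.lt_rot (n := d) h₂ (hd b ⟨hab.le, le_rfl⟩).1
    refine le_trans ?_ h.le
    have : ((l : ℝ) + 1) ≤ ((d + k₂ : ℕ) : ℝ) := by exact_mod_cast hu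
    nlinarith

/-- This closes the chain at the final arc. In the rectangle of angles between 2N + d' and 2N + d' +
1 quarter turns and energies [c₁, c₂], the rotated path joins the angular sides and T, shifted by N
half turns, joins the energy sides. -/
theorem exists_rot_eq {τ c₁ c₂ : ℝ} {S T : Set (ℝ × ℝ)} {d d' k₁ k₂ N : ℕ}
    (hS : HasCrossing c₁ c₂ S) (hT : HasCrossing c₁ c₂ T)
    (hd : ∀ q ∈ S, q.2 ∈ Icc (d * (Real.pi / 2)) ((d + 1) * (Real.pi / 2)))
    (hd' : ∀ q ∈ T, q.2 ∈ Icc (d' * (Real.pi / 2)) ((d' + 1) * (Real.pi / 2)))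
    (h₁ : τ < k₁ * O.quarter c₁) (h₂ : k₂ * O.quarter c₂ < τ)
    (hl : d + 1 + k₁ ≤ 2 * N + d') (hu : 2 * N + d' + 1 ≤ d + k₂) :
    ∃ q ∈ S, ∃ q' ∈ T, q.1 ∈ Icc c₁ c₂ ∧ q.1 = q'.1 ∧ O.rot τ q.1 q.2 = q'.2 + N * Real.pi := by
  obtain ⟨a, b, c, φ, hab, hcc, hφ, hca, hcb, hmem⟩ := hS
  obtain ⟨e, f, c', φ', hef, hcc', hφ', hce, hcf, hmem'⟩ := hT
  obtain ⟨a', b', ha', hab', hb', hra, hrb, hr⟩ := O.exists_subinterval_rot hab hcc hφ hca hcb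
    (fun r hr => hd _ (hmem r hr).2) h₁ h₂ hl hu
  have hsub : Icc a' b' ⊆ Icc a b := Icc_subset_Icc ha' hb'
  push_cast at hra hrb hr
  obtain ⟨s, hs, t, ht, hst, hst'⟩ := exists_crossing
    (f₁ := fun r => O.rot τ (c r) (φ r)) (g₁ := fun r => φ' r + N * Real.pi) hab'.le hef.le
    (O.continuousOn_rot τ (hcc.mono hsub) (hφ.mono hsub))
    (hcc.mono hsub) (hφ'.add continuousOn_const) hcc'
    (fun t ht => by
      have := (hd' _ (hmem' t ht).2).1
      simp only at this ⊢
      rw [hra]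
      linarith)
    (fun t ht => by
      have := (hd' _ (hmem' t ht).2).2
      simp only at this ⊢
      rw [hrb]
      linarith)
    (fun s hs => by rw [hce]; exact (hmem s (hsub hs)).1.1)
    (fun s hs => by rw [hcf]; exact (hmem s (hsub hs)).1.2)
  exact ⟨_, (hmem s (hsub hs)).2, _, (hmem' t ht).2, (hmem s (hsub hs)).1, hst', hst⟩

/-! ### The linear flow on a gap and its effect on the hump energy -/

/-- The point with clockwise polar angle `η` on the orbit of amplitude `ρ` of the linear system. -/
noncomputable def gapPoint (ρ η : ℝ) : ℝ × ℝ := (ρ / √O.lam * Real.sin η, ρ * Real.cos η)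

theorem hamiltonian_gapPoint (ρ η : ℝ) : hamiltonian O.lam O.μ O.p (O.gapPoint ρ η) =
    ρ ^ 2 / 2 + O.μ / (O.p + 1) * |ρ / √O.lam * Real.sin η| ^ (O.p + 1) := by
  have hl := O.lam_pos
  have h1 : √O.lam ^ 2 = O.lam := Real.sq_sqrt hl.le
  have h0 : √O.lam ≠ 0 := (Real.sqrt_pos.2 hl).ne'
  simp only [hamiltonian, potential, gapPoint, sq_abs]
  have : O.lam / 2 * (ρ / √O.lam * Real.sin η) ^ 2 = ρ ^ 2 / 2 * Real.sin η ^ 2 := by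
    rw [mul_pow, div_pow, h1]
    field_simp
  rw [this]
  linear_combination ρ ^ 2 / 2 * Real.sin_sq_add_cos_sq η

/-- By definition of x_com the nonlinear potential at that abscissa is exactly c₂ − c₁, and an
ellipse of linear energy at least c₁ lies beyond x_com at the angle θ. -/
theorem lt_of_xCom_lt {c₁ c₂ ρ θ : ℝ} (hc₁ : 0 < c₁) (hc : c₁ < c₂) (hρ : 0 ≤ ρ)
    (hρ2 : 2 * c₁ ≤ ρ ^ 2) (hθ : 0 ≤ Real.sin θ)
    (hcom : xCom O.μ O.p c₁ c₂ < √(2 * c₁ / O.lam) * Real.sin θ) :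
    c₂ - c₁ < O.μ / (O.p + 1) * |ρ / √O.lam * Real.sin θ| ^ (O.p + 1) := by
  have hl := O.lam_pos
  have hμ := O.μ_pos
  have hp := O.p_add_one_pos
  have hsl : 0 < √O.lam := Real.sqrt_pos.2 hl
  have h1 : √(2 * c₁ / O.lam) ≤ ρ / √O.lam := by
    rw [Real.sqrt_div (by linarith)]
    gcongr
    exact Real.sqrt_le_iff.2 ⟨hρ, hρ2⟩
  have hpos : 0 ≤ (O.p + 1) * (c₂ - c₁) / O.μ := by
    have : 0 ≤ c₂ - c₁ := by linarith
    positivity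
  have h2 : xCom O.μ O.p c₁ c₂ < ρ / √O.lam * Real.sin θ :=
    hcom.trans_le (mul_le_mul_of_nonneg_right h1 hθ)
  have h3 : 0 ≤ xCom O.μ O.p c₁ c₂ := Real.rpow_nonneg hpos _
  have h4 := Real.rpow_lt_rpow h3 h2 hp
  have h5 : xCom O.μ O.p c₁ c₂ ^ (O.p + 1) = (O.p + 1) * (c₂ - c₁) / O.μ := by
    unfold xCom
    rw [← Real.rpow_mul hpos, one_div, inv_mul_cancel₀ hp.ne', Real.rpow_one]
  rw [h5] at h4
  rw [abs_of_nonneg (h3.trans h2.le)]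
  rw [div_lt_iff₀ hμ] at h4
  rw [div_mul_eq_mul_div, lt_div_iff₀ hp]
  linarith

/-- The amplitude of a point with respect to the linear system. -/
noncomputable def gapRadius (z : ℝ × ℝ) : ℝ := √(O.lam * z.1 ^ 2 + z.2 ^ 2)

/-- The angle in `[-π/2, π/2]` of a point of the upper half-plane for the linear system. -/
noncomputable def gapAngle (z : ℝ × ℝ) : ℝ := Real.arcsin (√O.lam * z.1 / O.gapRadius z)

theorem gapRadius_pos {z : ℝ × ℝ} (hz : 0 < hamiltonian O.lam O.μ O.p z) : 0 < O.gapRadius z := by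
  have hl := O.lam_pos
  apply Real.sqrt_pos.2
  by_contra! h
  have h1 : z.2 = 0 := by nlinarith [sq_nonneg z.1, sq_nonneg z.2, mul_nonneg hl.le (sq_nonneg z.1)]
  have h2 : z.1 = 0 := by
    rw [h1] at h
    have : z.1 ^ 2 ≤ 0 := by nlinarith [sq_nonneg z.1]
    nlinarith [sq_nonneg z.1]
  rw [hamiltonian_eq, h1, h2, coord_zero] at hz
  norm_num at hz

theorem gapPoint_gapAngle {z : ℝ × ℝ} (hz : 0 < hamiltonian O.lam O.μ O.p z) (h2 : 0 ≤ z.2) :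
    O.gapPoint (O.gapRadius z) (O.gapAngle z) = z := by
  have hl := O.lam_pos
  have hsl : 0 < √O.lam := Real.sqrt_pos.2 hl
  have hsl2 : √O.lam ^ 2 = O.lam := Real.sq_sqrt hl.le
  have hr := O.gapRadius_pos hz
  have hr2 : O.gapRadius z ^ 2 = O.lam * z.1 ^ 2 + z.2 ^ 2 := Real.sq_sqrt (by positivity)
  have hle : |√O.lam * z.1 / O.gapRadius z| ≤ 1 := by
    rw [abs_div, abs_of_pos hr, div_le_one hr]
    apply abs_le_of_sq_le_sq _ hr.le
    rw [mul_pow, hsl2, hr2]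
    nlinarith [sq_nonneg z.2]
  have hle' := abs_le.1 hle
  apply Prod.ext
  · simp only [gapPoint, gapAngle]
    rw [Real.sin_arcsin hle'.1 hle'.2]
    field_simp
  · simp only [gapPoint, gapAngle]
    rw [Real.cos_arcsin]
    have : 1 - (√O.lam * z.1 / O.gapRadius z) ^ 2 = (z.2 / O.gapRadius z) ^ 2 := by
      field_simp
      rw [hr2, hsl2]
      ring
    rw [this, Real.sqrt_sq (by positivity), mul_div_cancel₀ _ hr.ne']

theorem continuous_gapRadius : Continuous O.gapRadius := by
  unfold gapRadius
  fun_prop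

theorem continuousOn_gapAngle :
    ContinuousOn O.gapAngle {z | 0 < hamiltonian O.lam O.μ O.p z} := by
  have h1 := O.continuous_gapRadius
  refine Real.continuous_arcsin.comp_continuousOn (ContinuousOn.div ?_ h1.continuousOn
    fun z hz => (O.gapRadius_pos hz).ne')
  exact Continuous.continuousOn (by fun_prop)

end Oscillator
end MooreNehari

/-! ### Stretching across a hump and a gap, and chains of states -/

namespace MooreNehari
namespace Oscillator

variable (O : Oscillator)

/-- `q'` is the state (energy and angle) at the beginning of a hump when `q` is the state at the
beginning of the previous hump, both up to central symmetry. The hump between them, of length `τ`,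
contains `N` zeros, and `θ` is the rotation on the gap modulo complete turns. -/
structure Link (τ θ c₁ c₂ : ℝ) (N : ℕ) (q q' : ℝ × ℝ) : Prop where
  energy_left : q.1 ∈ Icc c₁ c₂
  energy_right : q'.1 ∈ Icc c₁ c₂
  angle_right : q'.2 ∈ Ioo 0 (Real.pi / 2)
  rot_mem : O.rot τ q.1 q.2 ∈ Ioo (N * Real.pi + Real.pi / 2) ((N + 1) * Real.pi)
  exists_gapPoint : ∃ ρ > 0, ∃ η ∈ Ioo (-θ) 0,
    O.point q.1 (O.rot τ q.1 q.2 - (N + 1) * Real.pi) = O.gapPoint ρ η ∧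
    O.point q'.1 q'.2 = O.gapPoint ρ (η + θ)

theorem continuous_gapPoint : Continuous fun q : ℝ × ℝ => O.gapPoint q.1 q.2 := by
  unfold gapPoint
  fun_prop

theorem gapAngle_eq_neg_pi_div_two {z : ℝ × ℝ} (hz : 0 < hamiltonian O.lam O.μ O.p z)
    (h1 : z.1 ≤ 0) (h2 : z.2 = 0) : O.gapAngle z = -(Real.pi / 2) := by
  have hl := O.lam_pos
  have hr := O.gapRadius_pos hz
  have h : O.gapPoint (O.gapRadius z) (O.gapAngle z) = z := O.gapPoint_gapAngle hz h2.ge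
  have hc : O.gapRadius z * Real.cos (O.gapAngle z) = 0 := by
    rw [← h2]; exact congrArg Prod.snd h
  have hc' := (mul_eq_zero.1 hc).resolve_left hr.ne'
  have hnonpos : O.gapAngle z ≤ 0 := by
    apply Real.arcsin_nonpos.2
    apply div_nonpos_of_nonpos_of_nonneg _ hr.le
    exact mul_nonpos_of_nonneg_of_nonpos (Real.sqrt_nonneg _) h1
  have hlo : -(Real.pi / 2) ≤ O.gapAngle z := Real.neg_pi_div_two_le_arcsin _
  rcases hlo.eq_or_lt with h3 | h3
  · exact h3.symm
  · have := Real.cos_pos_of_mem_Ioo ⟨h3, by linarith [Real.pi_pos]⟩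
    linarith

/-- The nonlinear energy is lost on the way to the y-axis. If ρ² ≥ 2c₁ this loss exceeds c₂ − c₁, so
the initial energy would have exceeded c₂. -/
theorem amplitude_lt {c₁ c₂ ρ θ : ℝ} (hc₁ : 0 < c₁) (hc : c₁ < c₂) (hρ : 0 ≤ ρ)
    (hθ : 0 ≤ Real.sin θ) (hcom : xCom O.μ O.p c₁ c₂ < √(2 * c₁ / O.lam) * Real.sin θ)
    (h : hamiltonian O.lam O.μ O.p (O.gapPoint ρ (-θ)) ≤ c₂) :
    hamiltonian O.lam O.μ O.p (O.gapPoint ρ 0) < c₁ := by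
  rw [hamiltonian_gapPoint] at h ⊢
  have hp := O.p_add_one_pos.ne'
  rw [Real.sin_neg, mul_neg, abs_neg] at h
  simp only [Real.sin_zero, mul_zero, abs_zero, Real.zero_rpow hp, add_zero]
  by_contra! h3
  have := O.lt_of_xCom_lt hc₁ hc hρ (by linarith) hθ hcom
  linarith

/-- The reverse passage: on the y-axis all the energy is linear, and nonlinear energy is gained on
leaving it. -/
theorem lt_hamiltonian {c₁ c₂ ρ θ : ℝ} (hc₁ : 0 < c₁) (hc : c₁ < c₂) (hρ : 0 ≤ ρ)
    (hθ : 0 ≤ Real.sin θ) (hcom : xCom O.μ O.p c₁ c₂ < √(2 * c₁ / O.lam) * Real.sin θ)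
    (h : c₁ ≤ hamiltonian O.lam O.μ O.p (O.gapPoint ρ 0)) :
    c₂ < hamiltonian O.lam O.μ O.p (O.gapPoint ρ θ) := by
  rw [hamiltonian_gapPoint] at h ⊢
  have hp := O.p_add_one_pos.ne'
  simp only [Real.sin_zero, mul_zero, abs_zero, Real.zero_rpow hp, add_zero] at h
  have := O.lt_of_xCom_lt hc₁ hc hρ (by linarith) hθ hcom
  linarith

theorem point_sub_quarter {c ψ : ℝ} {n : ℕ} (h : ψ = (2 * n + 1 : ℕ) * (Real.pi / 2)) :
    O.point c (ψ - (n + 1) * Real.pi) = (O.coordInv (-√(2 * c)), 0) := by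
  have : ψ - (n + 1) * Real.pi = -(Real.pi / 2) := by rw [h]; push_cast; ring
  rw [this]
  simp [point]

theorem point_sub_half {c ψ : ℝ} {n : ℕ} (h : ψ = ((2 * n + 1 : ℕ) + 1) * (Real.pi / 2)) :
    O.point c (ψ - (n + 1) * Real.pi) = (0, √(2 * c)) := by
  have : ψ - (n + 1) * Real.pi = 0 := by rw [h]; push_cast; ring
  rw [this]
  simp [point, coordInv_zero]

/-- Stretching along a hump followed by a gap. -/
theorem hasCrossing_link {τ θ c₁ c₂ : ℝ} {S : Set (ℝ × ℝ)} {d k₁ k₂ N : ℕ}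
    (hc₁ : 0 < c₁) (hc : c₁ < c₂) (hθ : 0 < θ) (hθ2 : θ ≤ Real.pi / 2)
    (hcom : xCom O.μ O.p c₁ c₂ < √(2 * c₁ / O.lam) * Real.sin θ) (hS : HasCrossing c₁ c₂ S)
    (hd : ∀ q ∈ S, q.2 ∈ Icc (d * (Real.pi / 2)) ((d + 1) * (Real.pi / 2)))
    (h₁ : τ < k₁ * O.quarter c₁) (h₂ : k₂ * O.quarter c₂ < τ)
    (hl : d + 1 + k₁ ≤ 2 * N + 1) (hu : 2 * N + 1 + 1 ≤ d + k₂) :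
    HasCrossing c₁ c₂ {q' | ∃ q ∈ S, O.Link τ θ c₁ c₂ N q q'} := by
  have hpi := Real.pi_pos
  have hl0 := O.lam_pos
  have hsl : 0 < √O.lam := Real.sqrt_pos.2 hl0
  have hsin : 0 ≤ Real.sin θ := Real.sin_nonneg_of_nonneg_of_le_pi hθ.le (by linarith)
  obtain ⟨a₀, b₀, c, φ, hab₀, hcc, hφ, hca, hcb, hmem⟩ := hS
  -- First cut: the hump carries this piece across the sector [Nπ + π/2, (N+1)π]. Subtracting (N+1)π
  -- makes it quadrant II, with the linear angle η running from −π/2 to 0.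
  obtain ⟨a₁, b₁, ha₁, hab₁, hb₁, hra, hrb, hr⟩ := O.exists_subinterval_rot hab₀ hcc hφ hca hcb
    (fun r hr => hd _ (hmem r hr).2) h₁ h₂ hl hu
  have hs₁ : Icc a₁ b₁ ⊆ Icc a₀ b₀ := Icc_subset_Icc ha₁ hb₁
  set ψ : ℝ → ℝ := fun r => O.rot τ (c r) (φ r) with hψ
  have hψc : ContinuousOn ψ (Icc a₁ b₁) := O.continuousOn_rot τ (hcc.mono hs₁) (hφ.mono hs₁)
  set z : ℝ → ℝ × ℝ := fun r => O.point (c r) (ψ r - (N + 1) * Real.pi) with hz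
  have hzc : ContinuousOn z (Icc a₁ b₁) := by
    have h : ContinuousOn (fun r => (c r, ψ r - (N + 1) * Real.pi)) (Icc a₁ b₁) :=
      (hcc.mono hs₁).prodMk (hψc.sub continuousOn_const)
    simpa only [Function.comp_def] using O.continuous_point.comp_continuousOn h
  have hHz : ∀ r ∈ Icc a₁ b₁, hamiltonian O.lam O.μ O.p (z r) = c r := fun r hr =>
    O.hamiltonian_point (hc₁.le.trans (hmem r (hs₁ hr)).1.1) _
  have hHpos : ∀ r ∈ Icc a₁ b₁, 0 < hamiltonian O.lam O.μ O.p (z r) := fun r hr => by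
    rw [hHz r hr]; exact hc₁.trans_le (hmem r (hs₁ hr)).1.1
  have hz2 : ∀ r ∈ Icc a₁ b₁, 0 ≤ (z r).2 := fun r hr' => by
    have h := hr r hr'
    push_cast at h
    refine mul_nonneg (Real.sqrt_nonneg _) (Real.cos_nonneg_of_mem_Icc ⟨?_, ?_⟩)
    · linarith [h.1]
    · linarith [h.2]
  set ρ : ℝ → ℝ := fun r => O.gapRadius (z r) with hρ
  set η : ℝ → ℝ := fun r => O.gapAngle (z r) with hη
  have hρc : ContinuousOn ρ (Icc a₁ b₁) := O.continuous_gapRadius.comp_continuousOn hzc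
  have hηc : ContinuousOn η (Icc a₁ b₁) := O.continuousOn_gapAngle.comp hzc hHpos
  have hρpos : ∀ r ∈ Icc a₁ b₁, 0 < ρ r := fun r hr => O.gapRadius_pos (hHpos r hr)
  have hzg : ∀ r ∈ Icc a₁ b₁, O.gapPoint (ρ r) (η r) = z r := fun r hr =>
    O.gapPoint_gapAngle (hHpos r hr) (hz2 r hr)
  have hηa : η a₁ ≤ -θ := by
    have h := O.point_sub_quarter (c := c a₁) hra
    have : η a₁ = -(Real.pi / 2) := by
      refine O.gapAngle_eq_neg_pi_div_two (hHpos a₁ ⟨le_rfl, hab₁.le⟩) ?_ ?_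
      · rw [hz]; simp only [hψ, h]
        rw [← O.coordInv_zero]
        exact O.strictMono_coordInv.monotone (by linarith [Real.sqrt_nonneg (2 * c a₁)])
      · rw [hz]; simp only [hψ, h]
    linarith
  have hηb : 0 ≤ η b₁ := by
    have h := O.point_sub_half (c := c b₁) hrb
    have : (z b₁).1 = 0 := by rw [hz]; simp only [hψ, h]
    simp [hη, gapAngle, this]
  -- Second cut: only −θ ≤ η ≤ 0 is kept, so that the gap rotation lands in quadrant I.
  obtain ⟨a₂, b₂, ha₂, hab₂, hb₂, hηa₂, hηb₂, hη₂⟩ := exists_subinterval_crossing hab₁.le hηc hηa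
    (by linarith) hηb
  have hs₂ : Icc a₂ b₂ ⊆ Icc a₁ b₁ := Icc_subset_Icc ha₂ hb₂
  set z' : ℝ → ℝ × ℝ := fun r => O.gapPoint (ρ r) (η r + θ) with hz'
  have hzc' : ContinuousOn z' (Icc a₂ b₂) := by
    have h : ContinuousOn (fun r => (ρ r, η r + θ)) (Icc a₂ b₂) :=
      (hρc.mono hs₂).prodMk ((hηc.mono hs₂).add continuousOn_const)
    simpa only [Function.comp_def] using O.continuous_gapPoint.comp_continuousOn h
  have hlow : ∀ r ∈ Icc a₂ b₂, η r = -θ → hamiltonian O.lam O.μ O.p (z' r) < c₁ :=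
    fun r hr h => by
      have h1 := hzg r (hs₂ hr)
      rw [hz']
      simp only [h, neg_add_cancel]
      refine O.amplitude_lt hc₁ hc (hρpos r (hs₂ hr)).le hsin hcom ?_
      rw [← h, h1, hHz r (hs₂ hr)]
      exact (hmem r (hs₁ (hs₂ hr))).1.2
  have hhigh : ∀ r ∈ Icc a₂ b₂, η r = 0 → c₂ < hamiltonian O.lam O.μ O.p (z' r) :=
    fun r hr h => by
      have h1 := hzg r (hs₂ hr)
      rw [hz']
      simp only [h, zero_add]
      refine O.lt_hamiltonian hc₁ hc (hρpos r (hs₂ hr)).le hsin hcom ?_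
      rw [← h, h1, hHz r (hs₂ hr)]
      exact (hmem r (hs₁ (hs₂ hr))).1.1
  -- Third cut: after the gap the energy is below c₁ at one end and above c₂ at the other.
  obtain ⟨a₃, b₃, ha₃, hab₃, hb₃, hca₃, hcb₃, hc₃⟩ := exists_subinterval_crossing hab₂.le
    (O.continuous_hamiltonian.comp_continuousOn hzc')
    (hlow a₂ ⟨le_rfl, hab₂.le⟩ hηa₂).le hc (hhigh b₂ ⟨hab₂.le, le_rfl⟩ hηb₂).le
  have hs₃ : Icc a₃ b₃ ⊆ Icc a₂ b₂ := Icc_subset_Icc ha₃ hb₃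
  have hpos' : ∀ r ∈ Icc a₃ b₃, 0 < hamiltonian O.lam O.μ O.p (z' r) := fun r hr =>
    hc₁.trans_le (hc₃ r hr).1
  refine ⟨a₃, b₃, fun r => hamiltonian O.lam O.μ O.p (z' r), fun r => O.upperAngle (z' r), hab₃,
    O.continuous_hamiltonian.comp_continuousOn (hzc'.mono hs₃),
    O.continuousOn_upperAngle.comp (hzc'.mono hs₃) hpos', hca₃, hcb₃,
    fun r hr₃ => ⟨hc₃ r hr₃, (c r, φ r), (hmem r (hs₁ (hs₂ (hs₃ hr₃)))).2, ?_⟩⟩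
  have hr₂ := hs₃ hr₃
  have hr₁ := hs₂ hr₂
  have hr₀ := hs₁ hr₁
  have hρr := hρpos r hr₁
  -- Equality would push the energy after the gap out of [c₁, c₂]. This strictness keeps zeros of u
  -- and u' off the ends of the gap and makes the later counts exact.
  have hη1 : -θ < η r := lt_of_le_of_ne (hη₂ r hr₂).1 fun h =>
    absurd (hlow r hr₂ h.symm) (not_lt.2 (hc₃ r hr₃).1)
  have hη0 : η r < 0 := lt_of_le_of_ne (hη₂ r hr₂).2 fun h =>
    absurd (hhigh r hr₂ h) (not_lt.2 (hc₃ r hr₃).2)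
  have hsinpos : 0 < Real.sin (η r + θ) :=
    Real.sin_pos_of_pos_of_lt_pi (by linarith) (by linarith)
  have hcospos : 0 < Real.cos (η r + θ) := Real.cos_pos_of_mem_Ioo ⟨by linarith, by linarith⟩
  have hz'1 : 0 < (z' r).1 := mul_pos (div_pos hρr hsl) hsinpos
  have hz'2 : 0 < (z' r).2 := mul_pos hρr hcospos
  have hpt := O.point_upperAngle (hpos' r hr₃) hz'2.le
  refine ⟨(hmem r hr₀).1, hc₃ r hr₃, ⟨?_, ?_⟩, ⟨?_, ?_⟩, ρ r, hρr, η r, ⟨hη1, hη0⟩,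
    (hzg r hr₁).symm, hpt⟩
  · refine lt_of_le_of_ne (O.upperAngle_nonneg hz'1.le) fun h => ?_
    have h1 := congrArg Prod.fst hpt
    have h2 : O.upperAngle (z' r) = 0 := h.symm
    rw [h2] at h1
    simp [point, coordInv_zero] at h1
    linarith
  · refine lt_of_le_of_ne (Real.arcsin_le_pi_div_two _) fun h => ?_
    have h1 := congrArg Prod.snd hpt
    have h2 : O.upperAngle (z' r) = Real.pi / 2 := h
    rw [h2] at h1
    simp [point] at h1
    linarith
  · refine lt_of_le_of_ne ?_ fun h => ?_
    · have h := (hr r hr₁).1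
      push_cast at h
      calc _ = (2 * (N : ℝ) + 1) * (Real.pi / 2) := by ring
        _ ≤ _ := h
    · have h1 := O.point_sub_quarter (c := c r) (ψ := ψ r) (n := N)
        (by push_cast; simp only at h; rw [hψ]; simp only [← h]; ring)
      have h2 : ρ r * Real.cos (η r) = 0 := by
        have h3 := congrArg Prod.snd (hzg r hr₁)
        rw [hz] at h3
        simp only [h1] at h3
        exact h3
      have h4 := Real.cos_pos_of_mem_Ioo (x := η r) ⟨by linarith, by linarith⟩
      exact absurd h2 (mul_pos hρr h4).ne'
  · refine lt_of_le_of_ne ?_ fun h => ?_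
    · have h := (hr r hr₁).2
      push_cast at h
      calc _ ≤ (2 * (N : ℝ) + 1 + 1) * (Real.pi / 2) := h
        _ = _ := by ring
    · have h1 := O.point_sub_half (c := c r) (ψ := ψ r) (n := N)
        (by push_cast; simp only at h; rw [hψ]; simp only [h]; ring)
      have h2 : ρ r / √O.lam * Real.sin (η r) = 0 := by
        have h3 := congrArg Prod.fst (hzg r hr₁)
        rw [hz] at h3
        simp only [h1] at h3
        exact h3
      have h4 := Real.sin_neg_of_neg_of_neg_pi_lt (x := η r) hη0 (by linarith)
      exact absurd h2 (mul_neg_of_pos_of_neg (div_pos hρr hsl) h4).ne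

/-- Along a chain of humps and gaps there is an orbit with prescribed numbers of zeros on the humps
that joins two crossing paths. -/
theorem exists_chain {τ θ c₁ c₂ : ℝ} {S T : Set (ℝ × ℝ)} {m : ℕ} {d d' N k₁ k₂ : ℕ → ℕ}
    (hc₁ : 0 < c₁) (hc : c₁ < c₂) (hθ : 0 < θ) (hθ2 : θ ≤ Real.pi / 2)
    (hcom : xCom O.μ O.p c₁ c₂ < √(2 * c₁ / O.lam) * Real.sin θ)
    (hS : HasCrossing c₁ c₂ S) (hT : HasCrossing c₁ c₂ T)
    (hdS : ∀ q ∈ S, q.2 ∈ Icc (d 0 * (Real.pi / 2)) ((d 0 + 1) * (Real.pi / 2)))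
    (hdT : ∀ q ∈ T, q.2 ∈ Icc (d' m * (Real.pi / 2)) ((d' m + 1) * (Real.pi / 2)))
    (hd : ∀ i, d (i + 1) = 0) (hd' : ∀ i < m, d' i = 1)
    (h₁ : ∀ i ≤ m, τ < k₁ i * O.quarter c₁) (h₂ : ∀ i ≤ m, k₂ i * O.quarter c₂ < τ)
    (hl : ∀ i ≤ m, d i + 1 + k₁ i ≤ 2 * N i + d' i)
    (hu : ∀ i ≤ m, 2 * N i + d' i + 1 ≤ d i + k₂ i) :
    ∃ f : ℕ → ℝ × ℝ, f 0 ∈ S ∧ (∀ i < m, O.Link τ θ c₁ c₂ (N i) (f i) (f (i + 1))) ∧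
      ∃ q ∈ T, (f m).1 ∈ Icc c₁ c₂ ∧ (f m).1 = q.1 ∧
        O.rot τ (f m).1 (f m).2 = q.2 + N m * Real.pi := by
  -- The induction needs a whole crossing path of states reachable at hump n, each with its own
  -- history f, rather than a single chain.
  have key : ∀ n ≤ m, HasCrossing c₁ c₂ {q | q.2 ∈ Icc (d n * (Real.pi / 2))
      ((d n + 1) * (Real.pi / 2)) ∧ ∃ f : ℕ → ℝ × ℝ, f 0 ∈ S ∧
        (∀ i < n, O.Link τ θ c₁ c₂ (N i) (f i) (f (i + 1))) ∧ f n = q} := by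
    intro n
    induction n with
    | zero =>
      intro _
      obtain ⟨a, b, c, φ, hab, hcc, hφ, hca, hcb, hmem⟩ := hS
      exact ⟨a, b, c, φ, hab, hcc, hφ, hca, hcb, fun r hr => ⟨(hmem r hr).1, hdS _ (hmem r hr).2,
        fun _ => (c r, φ r), (hmem r hr).2, by simp, rfl⟩⟩
    | succ n ih =>
      intro hn
      have hn' : n < m := hn
      have h := O.hasCrossing_link hc₁ hc hθ hθ2 hcom (ih hn'.le) (fun q hq => hq.1) (h₁ n hn'.le)
        (h₂ n hn'.le) (N := N n) (by have := hl n hn'.le; rwa [hd' n hn'] at this)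
        (by have := hu n hn'.le; rwa [hd' n hn'] at this)
      obtain ⟨a, b, c, φ, hab, hcc, hφ, hca, hcb, hmem⟩ := h
      refine ⟨a, b, c, φ, hab, hcc, hφ, hca, hcb, fun r hr => ⟨(hmem r hr).1, ?_⟩⟩
      obtain ⟨q, ⟨-, f, hf0, hf, hfn⟩, hq⟩ := (hmem r hr).2
      have hang := hq.angle_right
      refine ⟨?_, fun i => if i ≤ n then f i else (c r, φ r), by simpa using hf0, fun i hi => ?_,
        by simp⟩
      · rw [hd n]
        simp only [Nat.cast_zero, zero_mul, zero_add, one_mul]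
        exact ⟨hang.1.le, hang.2.le⟩
      · rcases Nat.lt_succ_iff_lt_or_eq.1 hi with h | rfl
        · simp only [if_pos h.le, if_pos (Nat.succ_le_of_lt h)]
          exact hf i h
        · simp only [le_refl, if_true]
          rw [if_neg (by omega), hfn]
          exact hq
  obtain ⟨q, ⟨-, f, hf0, hf, rfl⟩, q', hq', h3, h4, h5⟩ := O.exists_rot_eq (key m le_rfl) hT
    (fun q hq => hq.1) hdT (h₁ m le_rfl) (h₂ m le_rfl) (hl m le_rfl) (hu m le_rfl)
  exact ⟨f, hf0, hf, q', hq', h3, h4, h5⟩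

end Oscillator
end MooreNehari

/-! ### Counting zeros, and assembling the orbit from humps and gaps -/

namespace MooreNehari

theorem continuousOn_Icc_of_pieces {X : Type*} [TopologicalSpace X] {b : ℕ → ℝ} (hb : StrictMono b)
    {f : ℝ → X} (K : ℕ) (hf : ∀ k ≤ K, ContinuousOn f (Icc (b k) (b (k + 1)))) :
    ContinuousOn f (Icc (b 0) (b (K + 1))) := by
  induction K with
  | zero => exact hf 0 le_rfl
  | succ K ih =>
    rw [← Icc_union_Icc_eq_Icc (hb.monotone (Nat.zero_le (K + 1)))
      (hb (Nat.lt_succ_self (K + 1))).le]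
    exact (ih fun k hk => hf k (by omega)).union_of_isClosed (hf (K + 1) le_rfl) isClosed_Icc
      isClosed_Icc

theorem exists_mem_Ioo_of_notMem_range {b : ℕ → ℝ} {x : ℝ} (K : ℕ)
    (hx : x ∈ Icc (b 0) (b (K + 1))) (hxb : x ∉ range b) :
    ∃ k ≤ K, x ∈ Ioo (b k) (b (k + 1)) := by
  have hne : ∀ k, x ≠ b k := fun k h => hxb ⟨k, h.symm⟩
  induction K with
  | zero => exact ⟨0, le_rfl, lt_of_le_of_ne hx.1 (hne 0).symm, lt_of_le_of_ne hx.2 (hne _)⟩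
  | succ K ih =>
    rcases le_total x (b (K + 1)) with h | h
    · obtain ⟨k, hk, hk'⟩ := ih ⟨hx.1, h⟩
      exact ⟨k, by omega, hk'⟩
    · exact ⟨K + 1, le_rfl, lt_of_le_of_ne h (hne _).symm, lt_of_le_of_ne hx.2 (hne _)⟩

/-- The multiples of π attained inside are k₀π, …, (k₀ + N − 1)π. The neighbouring multiples may be
attained at the end points, which the open interval omits. -/
theorem encard_sin_eq_zero {A : ℝ → ℝ} {a b : ℝ} {k₀ : ℤ} {N : ℕ} (hab : a ≤ b)
    (hA : StrictMonoOn A (Icc a b)) (hc : ContinuousOn A (Icc a b))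
    (ha : (k₀ - 1) * Real.pi ≤ A a) (ha' : A a < k₀ * Real.pi)
    (hb : (k₀ + N - 1) * Real.pi < A b) (hb' : A b ≤ (k₀ + N) * Real.pi) :
    {x | x ∈ Ioo a b ∧ Real.sin (A x) = 0}.encard = N := by
  have hpi := Real.pi_pos
  have hak : ∀ k : ℕ, A a < (k₀ + k) * Real.pi := fun k => by
    have : 0 ≤ (k : ℝ) * Real.pi := by positivity
    linarith
  have hbk : ∀ k < N, (k₀ + k) * Real.pi < A b := fun k hk => by
    have h1 : ((k : ℝ) + 1) ≤ N := by exact_mod_cast hk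
    nlinarith
  refine encard_eq_of_strictMonoOn (f := A) (v := fun k => (k₀ + k) * Real.pi) hab hA hc ?_
    (fun k hk => ⟨(hak k).le, (hbk k hk).le⟩) (fun x hx => Ioo_subset_Icc_self hx.1)
    fun x hx => ⟨fun h => ?_, ?_⟩
  · intro k l h
    have h2 := mul_right_cancel₀ hpi.ne' h
    exact_mod_cast add_left_cancel h2
  · have h1 := hA ⟨le_rfl, hab⟩ hx h.1.1
    have h2 := hA hx ⟨hab, le_rfl⟩ h.1.2
    exact (sin_eq_zero_iff_exists_nat (by linarith) (by linarith)).1 h.2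
  · rintro ⟨k, hk, h⟩
    refine ⟨⟨lt_of_le_of_ne hx.1 ?_, lt_of_le_of_ne hx.2 ?_⟩, ?_⟩
    · rintro rfl
      exact (hak k).ne h
    · rintro rfl
      exact (hbk k hk).ne' h
    · have := Real.sin_int_mul_pi (k₀ + k)
      push_cast at this
      rw [h, this]

theorem encard_cos_eq_zero {A : ℝ → ℝ} {a b : ℝ} {N : ℕ} (hab : a ≤ b)
    (hA : StrictMonoOn A (Icc a b)) (hc : ContinuousOn A (Icc a b))
    (ha : -(Real.pi / 2) ≤ A a) (ha' : A a < Real.pi / 2)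
    (hb : N * Real.pi - Real.pi / 2 < A b) (hb' : A b ≤ N * Real.pi + Real.pi / 2) :
    {x | x ∈ Ioo a b ∧ Real.cos (A x) = 0}.encard = N := by
  have h := encard_sin_eq_zero (A := fun x => A x - Real.pi / 2) (k₀ := 0) (N := N) hab
    (fun x hx y hy hxy => sub_lt_sub_right (hA hx hy hxy) _) (hc.sub continuousOn_const)
    (by push_cast; linarith) (by push_cast; linarith) (by push_cast; linarith)
    (by push_cast; linarith)
  simpa only [Real.sin_sub_pi_div_two, neg_eq_zero] using h

/-- The zeros of `sin ∘ A` when `A` runs from the quarter turn `d` to the quarter turn `d'` of the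
half turn `N`; the end points of the interval count only for `d = 1` and `d' = 0` respectively. -/
theorem encard_sin_eq_zero_of_shift {A : ℝ → ℝ} {a b : ℝ} {d d' N : ℕ} (hab : a < b)
    (hA : StrictMonoOn A (Icc a b)) (hc : ContinuousOn A (Icc a b)) (hd : d ≤ 1) (hd' : d' ≤ 1)
    (ha : A a ∈ Icc (d * (Real.pi / 2)) ((d + 1) * (Real.pi / 2)))
    (hb : A b - N * Real.pi ∈ Icc (d' * (Real.pi / 2)) ((d' + 1) * (Real.pi / 2))) :
    {x | (x ∈ Icc a b ∧ (x = a → d = 1) ∧ (x = b → d' = 0)) ∧ Real.sin (A x) = 0}.encard = N := by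
  have hpi := Real.pi_pos
  have hdr : (d : ℝ) ≤ 1 := by exact_mod_cast hd
  have hdr' : (d' : ℝ) ≤ 1 := by exact_mod_cast hd'
  have h0 : 0 ≤ A a := le_trans (by positivity) ha.1
  have h1 : A a ≤ Real.pi := ha.2.trans (by nlinarith)
  have h2 : N * Real.pi ≤ A b := by
    have : 0 ≤ (d' : ℝ) * (Real.pi / 2) := by positivity
    linarith [hb.1]
  have h3 : A b ≤ (N + 1) * Real.pi := by nlinarith [hb.2]
  have hv : ∀ k < N, ((k : ℝ) + 1) * Real.pi ≤ N * Real.pi := fun k hk => by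
    have : ((k : ℝ) + 1) ≤ N := by exact_mod_cast hk
    gcongr
  have hv0 : ∀ k : ℕ, Real.pi ≤ ((k : ℝ) + 1) * Real.pi := fun k => by
    have : 0 ≤ (k : ℝ) * Real.pi := by positivity
    linarith
  refine encard_eq_of_strictMonoOn (f := A) (v := fun k => ((k : ℝ) + 1) * Real.pi) hab.le hA hc ?_
    (fun k hk => ⟨h1.trans (hv0 k), (hv k hk).trans h2⟩) (fun x hx => hx.1.1)
    fun x hx => ⟨fun h => ?_, ?_⟩
  · intro k l h
    have h2 := mul_right_cancel₀ hpi.ne' h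
    exact_mod_cast add_right_cancel h2
  -- The zeros to be counted are π, …, Nπ. For d = 0 the start may have angle 0 and is left out,
  -- while for d = 1 it may have angle π and belongs to the count; similarly for (N+1)π and Nπ at
  -- the other end.
  · have hlo : 0 < A x := by
      rcases hx.1.eq_or_lt with rfl | hlt
      · have h5 : d = 1 := h.1.2.1 rfl
        rw [h5] at ha
        push_cast at ha
        linarith [ha.1]
      · exact h0.trans_lt (hA ⟨le_rfl, hab.le⟩ hx hlt)
    have hhi : A x < (N + 1) * Real.pi := by
      rcases hx.2.eq_or_lt with rfl | hlt
      · have h5 : d' = 0 := h.1.2.2 rfl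
        rw [h5] at hb
        push_cast at hb
        linarith [hb.2]
      · exact (hA hx ⟨hab.le, le_rfl⟩ hlt).trans_le h3
    obtain ⟨k, hk, h6⟩ := (sin_eq_zero_iff_exists_nat (k₀ := 1) (N := N)
      (by push_cast; linarith) (by push_cast; linarith)).1 h.2
    exact ⟨k, hk, by rw [h6]; push_cast; ring⟩
  · rintro ⟨k, hk, h⟩
    refine ⟨⟨hx, ?_, ?_⟩, ?_⟩
    · rintro rfl
      by_contra h5
      have h6 : d = 0 := by omega
      rw [h6] at ha
      push_cast at ha
      linarith [ha.2, hv0 k]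
    · rintro rfl
      by_contra h5
      have h6 : d' = 1 := by omega
      rw [h6] at hb
      push_cast at hb
      linarith [hb.1, hv k hk]
    · have := Real.sin_int_mul_pi (k + 1)
      push_cast at this
      rw [h, this]

/-- The end points of the humps, which have length `τ`, and of the gaps, which have length `ς`. -/
noncomputable def breakTime (τ ς : ℝ) (k : ℕ) : ℝ :=
  ((k / 2 : ℕ) : ℝ) * (τ + ς) + ((k % 2 : ℕ) : ℝ) * τ

theorem breakTime_even (τ ς : ℝ) (i : ℕ) : breakTime τ ς (2 * i) = i * (τ + ς) := by
  simp [breakTime]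

theorem breakTime_odd (τ ς : ℝ) (i : ℕ) : breakTime τ ς (2 * i + 1) = i * (τ + ς) + τ := by
  have h1 : (2 * i + 1) / 2 = i := by omega
  have h2 : (2 * i + 1) % 2 = 1 := by omega
  simp [breakTime, h1, h2]

theorem strictMono_breakTime {τ ς : ℝ} (hτ : 0 < τ) (hς : 0 < ς) :
    StrictMono (breakTime τ ς) := by
  refine strictMono_nat_of_lt_succ fun k => ?_
  obtain ⟨i, rfl | rfl⟩ := Nat.even_or_odd' k
  · rw [breakTime_even, breakTime_odd]
    linarith
  · rw [breakTime_odd, show 2 * i + 1 + 1 = 2 * (i + 1) by ring, breakTime_even]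
    push_cast
    linarith

theorem exists_glue_humps_gaps {τ ς : ℝ} (hτ : 0 < τ) (hς : 0 < ς) (m : ℕ)
    {F G : ℕ → ℝ → ℝ × ℝ} (hF : ∀ i, Continuous (F i)) (hG : ∀ i, Continuous (G i))
    (hFG : ∀ i < m, F i (i * (τ + ς) + τ) = G i (i * (τ + ς) + τ))
    (hGF : ∀ i < m, G i ((i + 1 : ℕ) * (τ + ς)) = F (i + 1) ((i + 1 : ℕ) * (τ + ς))) :
    ∃ w : ℝ → ℝ × ℝ, ContinuousOn w (Icc 0 (m * (τ + ς) + τ)) ∧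
      (∀ i ≤ m, EqOn w (F i) (Icc (i * (τ + ς)) (i * (τ + ς) + τ))) ∧
      (∀ i < m, EqOn w (G i) (Icc (i * (τ + ς) + τ) ((i + 1 : ℕ) * (τ + ς)))) ∧
      ∀ x ∈ Icc 0 (m * (τ + ς) + τ), x ∉ range (breakTime τ ς) →
        (∃ i ≤ m, x ∈ Ioo (i * (τ + ς)) (i * (τ + ς) + τ)) ∨
        ∃ i < m, x ∈ Ioo (i * (τ + ς) + τ) ((i + 1 : ℕ) * (τ + ς)) := by
  have hb := strictMono_breakTime hτ hς
  have hodd : ∀ i, 2 * i + 1 + 1 = 2 * (i + 1) := fun i => by ring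
  set P : ℕ → ℝ → ℝ × ℝ := fun k => if k % 2 = 0 then F (k / 2) else G (k / 2) with hP
  have hPe : ∀ i, P (2 * i) = F i := fun i => by simp [hP]
  have hPo : ∀ i, P (2 * i + 1) = G i := fun i => by
    have h1 : (2 * i + 1) / 2 = i := by omega
    have h2 : (2 * i + 1) % 2 = 1 := by omega
    simp [hP, h1, h2]
  obtain ⟨w, hw⟩ := exists_glue hb P (2 * m) (fun k hk => by
    obtain ⟨i, rfl | rfl⟩ := Nat.even_or_odd' k
    · rw [hPe, hPo, breakTime_odd]
      exact hFG i (by omega)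
    · rw [hPo, hodd, hPe, breakTime_even]
      exact hGF i (by omega))
  have h0 : breakTime τ ς 0 = 0 := by simpa using breakTime_even τ ς 0
  refine ⟨w, ?_, fun i hi => ?_, fun i hi => ?_, fun x hx hxb => ?_⟩
  · have h := continuousOn_Icc_of_pieces hb (f := w) (2 * m) fun k hk => by
      refine ContinuousOn.congr ?_ (hw k hk)
      obtain ⟨i, rfl | rfl⟩ := Nat.even_or_odd' k
      · rw [hPe]; exact (hF i).continuousOn
      · rw [hPo]; exact (hG i).continuousOn
    rwa [h0, breakTime_odd] at h
  · have h := hw (2 * i) (by omega)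
    rwa [hPe, breakTime_even, breakTime_odd] at h
  · have h := hw (2 * i + 1) (by omega)
    rwa [hPo, hodd, breakTime_even, breakTime_odd] at h
  · rw [← h0, ← breakTime_odd] at hx
    obtain ⟨k, hk, hk'⟩ := exists_mem_Ioo_of_notMem_range (2 * m) hx hxb
    obtain ⟨i, rfl | rfl⟩ := Nat.even_or_odd' k
    · rw [breakTime_even, breakTime_odd] at hk'
      exact Or.inl ⟨i, by omega, hk'⟩
    · rw [breakTime_odd, hodd, breakTime_even] at hk'
      exact Or.inr ⟨i, by omega, hk'⟩

theorem intervalIntegrable_stepWeight {m : ℕ} (t s μ : Fin (m + 1) → ℝ) (a b : ℝ) :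
    IntervalIntegrable (stepWeight t s μ) volume a b := by
  have h : Integrable (stepWeight t s μ) volume := by
    unfold stepWeight
    refine integrable_finsetSum _ fun i _ => ?_
    rw [integrable_indicator_iff measurableSet_Icc]
    exact integrableOn_const (by simp)
  exact h.intervalIntegrable

theorem stepWeight_of_mem {m : ℕ} {t s μ : Fin (m + 1) → ℝ} {x : ℝ} {i : Fin (m + 1)}
    (hi : x ∈ Icc (t i) (s i)) (hne : ∀ j, j ≠ i → x ∉ Icc (t j) (s j)) :
    stepWeight t s μ x = μ i := by
  unfold stepWeight
  rw [Finset.sum_eq_single i (fun j _ hj => indicator_of_notMem (hne j hj) _) (by simp),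
    indicator_of_mem hi]

theorem stepWeight_of_notMem {m : ℕ} {t s μ : Fin (m + 1) → ℝ} {x : ℝ}
    (hne : ∀ j, x ∉ Icc (t j) (s j)) : stepWeight t s μ x = 0 :=
  Finset.sum_eq_zero fun j _ => indicator_of_notMem (hne j) _

namespace Oscillator

variable (O : Oscillator)

theorem hasDerivAt_hump_fst (ε c s₀ t₀ x : ℝ) :
    HasDerivAt (fun y => (ε • O.point c (O.angle c (s₀ + (y - t₀)))).1)
      (ε • O.point c (O.angle c (s₀ + (x - t₀)))).2 x := by
  have h1 : HasDerivAt (fun y => s₀ + (y - t₀)) 1 x := ((hasDerivAt_id x).sub_const t₀).const_add s₀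
  have h := ((O.hasDerivAt_point_fst c (s₀ + (x - t₀))).comp x h1).const_mul ε
  rw [mul_one] at h
  exact h

theorem hasDerivAt_hump_snd {ε : ℝ} (hε : ε = 1 ∨ ε = -1) (c s₀ t₀ x : ℝ) :
    HasDerivAt (fun y => (ε • O.point c (O.angle c (s₀ + (y - t₀)))).2)
      (-(O.lam * (ε • O.point c (O.angle c (s₀ + (x - t₀)))).1 +
        O.μ * |(ε • O.point c (O.angle c (s₀ + (x - t₀)))).1| ^ (O.p - 1) *
          (ε • O.point c (O.angle c (s₀ + (x - t₀)))).1)) x := by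
  have h1 : HasDerivAt (fun y => s₀ + (y - t₀)) 1 x := ((hasDerivAt_id x).sub_const t₀).const_add s₀
  have h := ((O.hasDerivAt_point_snd c (s₀ + (x - t₀))).comp x h1).const_mul ε
  refine HasDerivAt.congr_deriv h ?_
  rcases hε with rfl | rfl
  · simp
  · simp only [Prod.smul_fst, smul_eq_mul, neg_mul, one_mul, abs_neg]
    ring

theorem hasDerivAt_gap_fst (ε ρ η t₀ x : ℝ) :
    HasDerivAt (fun y => (ε • O.gapPoint ρ (η + √O.lam * (y - t₀))).1)
      (ε • O.gapPoint ρ (η + √O.lam * (x - t₀))).2 x := by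
  have h0 : √O.lam ≠ 0 := (Real.sqrt_pos.2 O.lam_pos).ne'
  have h1 : HasDerivAt (fun y => η + √O.lam * (y - t₀)) (√O.lam) x := by
    simpa using (((hasDerivAt_id x).sub_const t₀).const_mul (√O.lam)).const_add η
  have h := ((h1.sin).const_mul (ρ / √O.lam)).const_mul ε
  refine HasDerivAt.congr_deriv h ?_
  simp only [gapPoint, Prod.smul_mk, smul_eq_mul]
  field_simp

theorem hasDerivAt_gap_snd (ε ρ η t₀ x : ℝ) :
    HasDerivAt (fun y => (ε • O.gapPoint ρ (η + √O.lam * (y - t₀))).2)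
      (-(O.lam * (ε • O.gapPoint ρ (η + √O.lam * (x - t₀))).1)) x := by
  have h0 : √O.lam ≠ 0 := (Real.sqrt_pos.2 O.lam_pos).ne'
  have hsq : √O.lam ^ 2 = O.lam := Real.sq_sqrt O.lam_pos.le
  have h1 : HasDerivAt (fun y => η + √O.lam * (y - t₀)) (√O.lam) x := by
    simpa using (((hasDerivAt_id x).sub_const t₀).const_mul (√O.lam)).const_add η
  have h := ((h1.cos).const_mul ρ).const_mul ε
  refine HasDerivAt.congr_deriv h ?_
  simp only [gapPoint, Prod.smul_mk, smul_eq_mul]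
  field_simp
  rw [hsq]
  ring

theorem point_eq_smul (c φ : ℝ) (n : ℕ) :
    O.point c φ = (-1 : ℝ) ^ n • O.point c (φ - n * Real.pi) := by
  induction n with
  | zero => simp
  | succ n ih =>
    have h := O.point_add_pi c (φ - (n + 1 : ℕ) * Real.pi)
    rw [show φ - (n + 1 : ℕ) * Real.pi + Real.pi = φ - n * Real.pi by push_cast; ring] at h
    rw [ih, h, pow_succ]
    simp

/-- The orbit that follows a chain of states. -/
theorem exists_trajectory {τ ς θ c₁ c₂ : ℝ} {m ξ : ℕ} {N : ℕ → ℕ} {f : ℕ → ℝ × ℝ} {e : ℕ → ℝ}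
    (hτ : 0 < τ) (hς : 0 < ς) (hθ : √O.lam * ς = θ + ξ * (2 * Real.pi))
    (he : ∀ i < m, e (i + 1) = e i * (-1) ^ (N i + 1))
    (hlink : ∀ i < m, O.Link τ θ c₁ c₂ (N i) (f i) (f (i + 1))) :
    ∃ (w : ℝ → ℝ × ℝ) (ρ η : ℕ → ℝ), ContinuousOn w (Icc 0 (m * (τ + ς) + τ)) ∧
      (∀ i ≤ m, ∀ x ∈ Icc (i * (τ + ς)) (i * (τ + ς) + τ), w x = e i • O.point (f i).1
        (O.angle (f i).1 (O.clock (f i).1 (f i).2 + (x - i * (τ + ς))))) ∧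
      (∀ i < m, 0 < ρ i ∧ η i ∈ Ioo (-θ) 0 ∧
        ∀ x ∈ Icc (i * (τ + ς) + τ) ((i + 1 : ℕ) * (τ + ς)),
          w x = e (i + 1) • O.gapPoint (ρ i) (η i + √O.lam * (x - (i * (τ + ς) + τ)))) ∧
      ∀ x ∈ Icc 0 (m * (τ + ς) + τ), x ∉ range (breakTime τ ς) →
        (∃ i ≤ m, x ∈ Ioo (i * (τ + ς)) (i * (τ + ς) + τ)) ∨
        ∃ i < m, x ∈ Ioo (i * (τ + ς) + τ) ((i + 1 : ℕ) * (τ + ς)) := by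
  have hg : ∀ i, ∃ ρ η : ℝ, i < m → 0 < ρ ∧ η ∈ Ioo (-θ) 0 ∧
      O.point (f i).1 (O.rot τ (f i).1 (f i).2 - (N i + 1) * Real.pi) = O.gapPoint ρ η ∧
      O.point (f (i + 1)).1 (f (i + 1)).2 = O.gapPoint ρ (η + θ) := fun i => by
    by_cases h : i < m
    · obtain ⟨ρ, hρ, η, hη, h1, h2⟩ := (hlink i h).exists_gapPoint
      exact ⟨ρ, η, fun _ => ⟨hρ, hη, h1, h2⟩⟩
    · exact ⟨0, 0, fun h' => absurd h' h⟩
  choose ρ η hρη using hg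
  obtain ⟨w, hw, hwF, hwG, hcov⟩ := exists_glue_humps_gaps hτ hς m
    (F := fun i x => e i • O.point (f i).1
        (O.angle (f i).1 (O.clock (f i).1 (f i).2 + (x - i * (τ + ς)))))
    (G := fun i x => e (i + 1) • O.gapPoint (ρ i) (η i + √O.lam * (x - (i * (τ + ς) + τ))))
    (fun i => by
      have h : Continuous fun x : ℝ => ((f i).1,
          O.angle (f i).1 (O.clock (f i).1 (f i).2 + (x - i * (τ + ς)))) :=
        continuous_const.prodMk ((O.continuous_angle_right _).comp (by fun_prop))
      exact Continuous.const_smul (by simpa using O.continuous_point.comp' h) (e i))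
    (fun i => by
      have h : Continuous fun x : ℝ => (ρ i, η i + √O.lam * (x - (i * (τ + ς) + τ))) := by fun_prop
      exact Continuous.const_smul (by simpa using O.continuous_gapPoint.comp' h) (e (i + 1)))
    (fun i hi => by
      obtain ⟨-, -, h1, -⟩ := hρη i hi
      -- The N + 1 half turns removed to reach quadrant II reappear as the factor (−1)^(N+1) between
      -- the signs of consecutive humps.
      have h2 := O.point_eq_smul (f i).1 (O.rot τ (f i).1 (f i).2) (N i + 1)
      push_cast at h2
      rw [h1] at h2
      simp only [add_sub_cancel_left, sub_self, mul_zero, add_zero]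
      rw [he i hi, mul_smul, ← h2, rot])
    (fun i hi => by
      obtain ⟨-, -, -, h1⟩ := hρη i hi
      have h3 : η i + √O.lam * ((i + 1 : ℕ) * (τ + ς) - (i * (τ + ς) + τ)) =
          η i + θ + ξ * (2 * Real.pi) := by
        have : ((i + 1 : ℕ) : ℝ) * (τ + ς) - (i * (τ + ς) + τ) = ς := by push_cast; ring
        rw [this, hθ]
        ring
      simp only [sub_self, add_zero, angle_clock]
      rw [h3, h1]
      simp only [gapPoint, Real.sin_add_nat_mul_two_pi, Real.cos_add_nat_mul_two_pi])
  exact ⟨w, ρ, η, hw, fun i hi x hx => hwF i hi hx, fun i hi => ⟨(hρη i hi).1, (hρη i hi).2.1,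
    fun x hx => hwG i hi hx⟩, hcov⟩

end Oscillator
end MooreNehari

/-! ### From a chain of states to a solution with prescribed nodes -/

namespace MooreNehari

/-- The localization and nodal properties of `HasItinerary`, with arbitrary numbers `N i` of zeros
on the humps. -/
structure HasNodes {m : ℕ} (t s : Fin (m + 1) → ℝ) (A : Set (ℝ × ℝ)) (q₀ q_L : Quadrant)
    (ξ : ℕ) (κ : Fin m → Block) (N : ℕ → ℕ) (u : ℝ → ℝ) : Prop where
  initial : phase (s (Fin.last m)) u 0 ∈ A ∩ q₀.region
  final : phase (s (Fin.last m)) u (s (Fin.last m)) ∈ A ∩ q_L.region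
  gap_start : ∀ i : Fin m, phase (s (Fin.last m)) u (s i.castSucc) ∈ A ∩ (κ i).source
  gap_end : ∀ i : Fin m, phase (s (Fin.last m)) u (t i.succ) ∈ A ∩ (κ i).quadrant.region
  gap_zeros : ∀ i : Fin m,
    {x | x ∈ Ioo (s i.castSucc) (t i.succ) ∧ u x = 0}.encard = ((2 * ξ + 1 : ℕ) : ℕ∞)
  gap_slope_zeros : ∀ i : Fin m,
    {x | x ∈ Ioo (s i.castSucc) (t i.succ) ∧ slope (s (Fin.last m)) u x = 0}.encard =
      ((2 * ξ : ℕ) : ℕ∞)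
  hump_zeros : ∀ i : Fin (m + 1), {x | x ∈ humpTimes t s q₀ q_L i ∧ u x = 0}.encard = (N i : ℕ∞)
  hump_slope_zeros : ∀ i : Fin (m + 1), i ≠ 0 → i ≠ Fin.last m →
    {x | x ∈ Ioo (t i) (s i) ∧ slope (s (Fin.last m)) u x = 0}.encard = ((N i + 1 : ℕ) : ℕ∞)

theorem Quadrant.shift_eq_one_iff (q : Quadrant) : q.shift = 1 ↔ q = .II ∨ q = .IV := by
  cases q <;> simp [Quadrant.shift]

theorem Quadrant.shift_eq_zero_iff (q : Quadrant) : q.shift = 0 ↔ q = .I ∨ q = .III := by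
  cases q <;> simp [Quadrant.shift]

theorem Quadrant.shift_le_one (q : Quadrant) : q.shift ≤ 1 := by
  cases q <;> simp [Quadrant.shift]

theorem Quadrant.sign_otherSide (q : Quadrant) : q.otherSide.sign = -q.sameSide.sign := by
  cases q <;> simp [Quadrant.otherSide, Quadrant.sameSide, Block.sign]

theorem Block.sign_smul_mem_region (b : Block) {z : ℝ × ℝ} (h1 : 0 ≤ z.1) (h2 : 0 ≤ z.2) :
    b.sign • z ∈ b.quadrant.region := by
  cases b <;> simp [Block.sign, Block.quadrant, Quadrant.region, h1, h2]

/-- Of the half annulus at the beginning of a gap, only the quadrant II, or IV after reflection, is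
used. -/
theorem Block.sign_smul_mem_source (b : Block) {z : ℝ × ℝ} (h1 : z.1 ≤ 0) (h2 : 0 ≤ z.2) :
    b.sign • z ∈ b.source := by
  cases b
  · exact Or.inl (by simpa [Block.sign, Quadrant.region] using ⟨h1, h2⟩)
  · exact Or.inl (by simpa [Block.sign, Quadrant.region] using ⟨h1, h2⟩)

theorem fullItinerary_castSucc_succ {m : ℕ} (q₀ q_L : Quadrant) (κ : Fin m → Block) (i : Fin m) :
    fullItinerary q₀ q_L κ i.castSucc.succ = κ i := by
  simp [fullItinerary]

theorem fullItinerary_last {m : ℕ} (q₀ q_L : Quadrant) (κ : Fin m → Block) :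
    fullItinerary q₀ q_L κ (Fin.last m).succ = q_L.otherSide := by
  simp [fullItinerary]

namespace Oscillator

variable (O : Oscillator)

theorem exists_solution {τ ς θ c₁ c₂ : ℝ} {m ξ : ℕ} {t s : Fin (m + 1) → ℝ}
    {r₀ r_L : Set (ℝ × ℝ)} {q₀ q_L : Quadrant} {N k₁ k₂ : ℕ → ℕ} (κ : Fin m → Block)
    (hτ : 0 < τ) (hς : 0 < ς) (ht : ∀ i, t i = (i : ℕ) * (τ + ς))
    (hs : ∀ i, s i = (i : ℕ) * (τ + ς) + τ)
    (hr₀ : IsUnboundedArc r₀) (hq₀ : r₀ ⊆ q₀.region)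
    (hr_L : IsUnboundedArc r_L) (hq_L : r_L ⊆ q_L.region)
    (hc₁ : 0 < c₁) (hc : c₁ < c₂) (hθ0 : 0 < θ) (hθ2 : θ ≤ Real.pi / 2)
    (hθ : √O.lam * ς = θ + ξ * (2 * Real.pi))
    (hcom : xCom O.μ O.p c₁ c₂ < √(2 * c₁ / O.lam) * Real.sin θ)
    (hpar : ∀ i : Fin (m + 1), (fullItinerary q₀ q_L κ i.succ).sign =
      (fullItinerary q₀ q_L κ i.castSucc).sign * (-1) ^ (N i + 1))
    (h₁ : ∀ i ≤ m, τ < k₁ i * O.quarter c₁) (h₂ : ∀ i ≤ m, k₂ i * O.quarter c₂ < τ)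
    (hl : ∀ i ≤ m, (if i = 0 then q₀.shift else 0) + 1 + k₁ i ≤
      2 * N i + if i = m then q_L.shift else 1)
    (hu : ∀ i ≤ m, 2 * N i + (if i = m then q_L.shift else 1) + 1 ≤
      (if i = 0 then q₀.shift else 0) + k₂ i) :
    ∃ u, IsSolution O.lam O.p (s (Fin.last m)) (stepWeight t s fun _ => O.μ) r₀ r_L u ∧
      HasNodes t s (annulus O.lam O.μ O.p c₁ c₂) q₀ q_L ξ κ N u := by
  have hpi := Real.pi_pos
  have hsl : 0 < √O.lam := Real.sqrt_pos.2 O.lam_pos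
  set L := s (Fin.last m) with hLdef
  have hL : L = m * (τ + ς) + τ := by rw [hLdef, hs]; simp
  have hτς : 0 < τ + ς := by linarith
  have hL0 : 0 < L := by rw [hL]; positivity
  set d : ℕ → ℕ := fun i => if i = 0 then q₀.shift else 0 with hd
  set d' : ℕ → ℕ := fun i => if i = m then q_L.shift else 1 with hd'
  have hd1 : ∀ i, d i ≤ 1 := fun i => by
    simp only [hd]; split_ifs <;> simp [Quadrant.shift_le_one]
  have hd1' : ∀ i, d' i ≤ 1 := fun i => by
    simp only [hd']; split_ifs <;> simp [Quadrant.shift_le_one]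
  -- The chain is built up to central symmetry; e i restores the half-plane of hump i. The default
  -- value beyond m + 1 is arbitrary up to sign.
  set e : ℕ → ℝ := fun n => if h : n < m + 2 then (fullItinerary q₀ q_L κ ⟨n, h⟩).sign else 1
    with he
  have he0 : e 0 = q₀.sameSide.sign := by
    simp only [he]; rw [dif_pos (by omega)]; rfl
  have he1 : ∀ i : ℕ, i ≤ m → e (i + 1) = e i * (-1) ^ (N i + 1) := fun i hi => by
    have h := hpar ⟨i, by omega⟩
    simp only [he]
    rw [dif_pos (by omega), dif_pos (by omega)]
    exact h
  have heκ : ∀ i : Fin m, e (i + 1) = (κ i).sign := fun i => by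
    have h := fullItinerary_castSucc_succ q₀ q_L κ i
    simp only [he]
    rw [dif_pos (by omega), ← h]
    rfl
  -- The last hump is followed by no gap, so one half turn less is counted; this is why the
  -- completed itinerary ends with the opposite side.
  have heL : e m * (-1) ^ N m = q_L.sameSide.sign := by
    have h := he1 m le_rfl
    have h2 : e (m + 1) = q_L.otherSide.sign := by
      have h3 := fullItinerary_last q₀ q_L κ
      simp only [he]
      rw [dif_pos (by omega), ← h3]
      rfl
    rw [h2, Quadrant.sign_otherSide, pow_succ] at h
    linarith
  have hesign : ∀ i, e i = 1 ∨ e i = -1 := fun i => by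
    simp only [he]
    split_ifs
    · exact Block.sign_eq_one_or _
    · exact Or.inl rfl
  have hene : ∀ i, e i ≠ 0 := fun i => by rcases hesign i with h | h <;> rw [h] <;> norm_num
  obtain ⟨f, hf0, hlink, q, hq, hfm, hfq, hrot⟩ := O.exists_chain (d := d) (d' := d') hc₁ hc hθ0 hθ2
    hcom (O.hasCrossing_of_isUnboundedArc hr₀ hq₀ hc₁ hc)
    (O.hasCrossing_of_isUnboundedArc hr_L hq_L hc₁ hc)
    (fun q hq => by simpa [hd] using hq.1) (fun q hq => by simpa [hd'] using hq.1)
    (fun i => by simp [hd]) (fun i hi => by simp [hd', hi.ne]) h₁ h₂ hl hu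
  obtain ⟨w, ρ, η, hw, hwF, hwG, hcov⟩ := O.exists_trajectory hτ hς hθ (fun i hi => he1 i hi.le) hlink
  rw [← hL] at hw hcov
  have hcmem : ∀ i ≤ m, (f i).1 ∈ Icc c₁ c₂ := fun i hi => by
    rcases hi.lt_or_eq with h | rfl
    · exact (hlink i h).energy_left
    · exact hfm
  set A : ℕ → ℝ → ℝ := fun i x =>
    O.angle (f i).1 (O.clock (f i).1 (f i).2 + (x - i * (τ + ς))) with hA
  have hAmono : ∀ i, StrictMono (A i) := fun i x y hxy =>
    O.strictMono_angle _ (by linarith)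
  have hAcont : ∀ i, Continuous (A i) := fun i =>
    (O.continuous_angle_right _).comp (by fun_prop)
  have hA0 : ∀ i : ℕ, A i (i * (τ + ς)) = (f i).2 := fun i => by
    simp only [hA, sub_self, add_zero, angle_clock]
  have hA1 : ∀ i : ℕ, A i (i * (τ + ς) + τ) = O.rot τ (f i).1 (f i).2 := fun i => by
    simp only [hA, add_sub_cancel_left, rot]
  have hφ : ∀ i ≤ m, (f i).2 ∈ Icc (d i * (Real.pi / 2)) ((d i + 1) * (Real.pi / 2)) := fun i hi => by
    rcases i with _ | i
    · simpa [hd] using hf0.1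
    · have h := (hlink i hi).angle_right
      simp only [hd, Nat.add_one_ne_zero, if_false, Nat.cast_zero, zero_mul, zero_add, one_mul]
      exact ⟨h.1.le, h.2.le⟩
  have hψ : ∀ i ≤ m, O.rot τ (f i).1 (f i).2 - N i * Real.pi ∈
      Icc (d' i * (Real.pi / 2)) ((d' i + 1) * (Real.pi / 2)) := fun i hi => by
    rcases hi.lt_or_eq with h | rfl
    · have h := (hlink i h).rot_mem
      simp only [hd', if_neg (Nat.ne_of_lt ‹i < m›), Nat.cast_one, one_mul]
      exact ⟨by linarith [h.1], by linarith [h.2]⟩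
    · rw [hrot, add_sub_cancel_right]
      simpa [hd'] using hq.1
  have hT : ∀ i j : ℕ, i < j → (i : ℝ) * (τ + ς) + τ + ς ≤ j * (τ + ς) := fun i j hij => by
    have : (i : ℝ) + 1 ≤ j := by exact_mod_cast hij
    nlinarith
  have hTm : ∀ i ≤ m, (i : ℝ) * (τ + ς) + τ ≤ L := fun i hi => by
    have : (i : ℝ) ≤ m := by exact_mod_cast hi
    rw [hL]
    nlinarith
  have hT0 : ∀ i : ℕ, 0 ≤ (i : ℝ) * (τ + ς) := fun i => by positivity
  have hhump : ∀ i ≤ m, Icc ((i : ℝ) * (τ + ς)) (i * (τ + ς) + τ) ⊆ Icc 0 L := fun i hi =>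
    Icc_subset_Icc (hT0 i) (hTm i hi)
  have hgap : ∀ i < m, Icc ((i : ℝ) * (τ + ς) + τ) ((i + 1 : ℕ) * (τ + ς)) ⊆ Icc 0 L := fun i hi =>
    Icc_subset_Icc (by linarith [hT0 i]) (by linarith [hTm (i + 1) hi])
  have hgapς : ∀ i : ℕ, ((i + 1 : ℕ) : ℝ) * (τ + ς) = i * (τ + ς) + τ + ς := fun i => by
    push_cast; ring
  have hw_hump : ∀ i ≤ m, ∀ x ∈ Icc ((i : ℝ) * (τ + ς)) (i * (τ + ς) + τ),
      w x = e i • O.point (f i).1 (A i x) := hwF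
  set u : ℝ → ℝ := fun x => (w x).1 with hu_def
  set v : ℝ → ℝ := fun x => (w x).2 with hv_def
  have hcover : ∀ x ∈ Ioo 0 L \ range (breakTime τ ς), HasDerivAt u (v x) x ∧ HasDerivAt v
      (-(O.lam * u x + stepWeight t s (fun _ => O.μ) x * |u x| ^ (O.p - 1) * u x)) x := by
    rintro x ⟨hx, hxb⟩
    rcases hcov x (Ioo_subset_Icc_self hx) hxb with ⟨i, hi, hxi⟩ | ⟨i, hi, hxi⟩
    · have hwev : w =ᶠ[𝓝 x] fun y => e i • O.point (f i).1
          (O.angle (f i).1 (O.clock (f i).1 (f i).2 + (y - i * (τ + ς)))) := by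
        filter_upwards [Ioo_mem_nhds hxi.1 hxi.2] with y hy
        exact hwF i hi y (Ioo_subset_Icc_self hy)
      have hwx := hwev.eq_of_nhds
      have hstep : stepWeight t s (fun _ => O.μ) x = O.μ := by
        refine stepWeight_of_mem (i := ⟨i, by omega⟩) ?_ fun j hj hmem => ?_
        · rw [ht, hs]
          exact Ioo_subset_Icc_self hxi
        · rw [ht, hs] at hmem
          have hne : (j : ℕ) ≠ i := fun h => hj (Fin.ext h)
          rcases lt_or_gt_of_ne hne with h | h
          · linarith [hT _ _ h, hmem.2, hxi.1]
          · linarith [hT _ _ h, hmem.1, hxi.2]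
      rw [hstep]
      constructor
      · have h := (O.hasDerivAt_hump_fst (e i) (f i).1 (O.clock (f i).1 (f i).2)
          (i * (τ + ς)) x).congr_of_eventuallyEq (hwev.fun_comp Prod.fst)
        simp only [hv_def, hwx]
        exact h
      · have h := (O.hasDerivAt_hump_snd (hesign i) (f i).1 (O.clock (f i).1 (f i).2)
          (i * (τ + ς)) x).congr_of_eventuallyEq (hwev.fun_comp Prod.snd)
        simp only [hu_def, hwx]
        exact h
    · obtain ⟨-, -, hwGi⟩ := hwG i hi
      have hwev : w =ᶠ[𝓝 x] fun y =>
          e (i + 1) • O.gapPoint (ρ i) (η i + √O.lam * (y - (i * (τ + ς) + τ))) := by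
        filter_upwards [Ioo_mem_nhds hxi.1 hxi.2] with y hy
        exact hwGi y (Ioo_subset_Icc_self hy)
      have hwx := hwev.eq_of_nhds
      have hstep : stepWeight t s (fun _ => O.μ) x = 0 := by
        refine stepWeight_of_notMem fun j hmem => ?_
        rw [ht, hs] at hmem
        rcases le_or_gt (j : ℕ) i with h | h
        · have : ((j : ℕ) : ℝ) ≤ i := by exact_mod_cast h
          nlinarith [hmem.2, hxi.1]
        · have : ((i + 1 : ℕ) : ℝ) ≤ (j : ℕ) := by exact_mod_cast h
          nlinarith [hmem.1, hxi.2]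
      rw [hstep, zero_mul, zero_mul, add_zero]
      constructor
      · have h := (O.hasDerivAt_gap_fst (e (i + 1)) (ρ i) (η i)
          (i * (τ + ς) + τ) x).congr_of_eventuallyEq (hwev.fun_comp Prod.fst)
        simp only [hv_def, hwx]
        exact h
      · have h := (O.hasDerivAt_gap_snd (e (i + 1)) (ρ i) (η i)
          (i * (τ + ς) + τ) x).congr_of_eventuallyEq (hwev.fun_comp Prod.snd)
        simp only [hu_def, hwx]
        exact h
  have hw0 : w 0 = q₀.sameSide.sign • O.point (f 0).1 (f 0).2 := by
    have h := hw_hump 0 (Nat.zero_le _) 0 (by simpa using hτ.le)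
    have h2 := hA0 0
    simp only [Nat.cast_zero, zero_mul] at h2
    rw [h, he0, h2]
  have hw0r : w 0 ∈ r₀ := by rw [hw0]; exact hf0.2
  have hwL : w L = q_L.sameSide.sign • O.point q.1 q.2 := by
    have h := hw_hump m le_rfl L ⟨by rw [hL]; linarith, by rw [hL]⟩
    rw [h, ← heL, hL, hA1, hrot, O.point_eq_smul _ _ (N m), add_sub_cancel_right, hfq, mul_smul]
  have hwLr : w L ∈ r_L := by rw [hwL]; exact hq.2
  obtain ⟨hsol, hslope⟩ := isSolution_of_hasDerivAt hL0 O.one_lt_p (countable_range _)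
    (intervalIntegrable_stepWeight t s _ 0 L) (continuous_fst.comp_continuousOn hw)
    (continuous_snd.comp_continuousOn hw) (fun x hx => (hcover x hx).1)
    (fun x hx => (hcover x hx).2) hw0r hwLr
  have hphase : ∀ x ∈ Icc 0 L, phase L u x = w x := fun x hx =>
    Prod.ext rfl (hslope x hx)
  have hslope' : ∀ x ∈ Icc 0 L, slope (s (Fin.last m)) u x = v x := hslope
  have hsi : ∀ i : Fin m, s i.castSucc = (i : ℕ) * (τ + ς) + τ := fun i => by
    rw [hs, Fin.val_castSucc]
  have hti : ∀ i : Fin m, t i.succ = ((i : ℕ) + 1 : ℕ) * (τ + ς) := fun i => by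
    rw [ht, Fin.val_succ]
  have hann : ∀ i ≤ m, ∀ x ∈ Icc ((i : ℝ) * (τ + ς)) (i * (τ + ς) + τ),
      w x ∈ annulus O.lam O.μ O.p c₁ c₂ := fun i hi x hx => by
    rw [annulus, mem_ofPred_eq, hw_hump i hi x hx, O.hamiltonian_smul (hesign i),
      O.hamiltonian_point (hc₁.le.trans (hcmem i hi).1)]
    exact hcmem i hi
  have hgapmono : ∀ i, StrictMono fun x : ℝ => η i + √O.lam * (x - (i * (τ + ς) + τ)) :=
    fun i x y hxy => by
      have : √O.lam * (x - (i * (τ + ς) + τ)) < √O.lam * (y - (i * (τ + ς) + τ)) :=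
        mul_lt_mul_of_pos_left (by linarith) hsl
      linarith
  have hgapend : ∀ i : ℕ, η i + √O.lam * ((i * (τ + ς) + τ + ς) - (i * (τ + ς) + τ)) =
      η i + θ + ξ * (2 * Real.pi) := fun i => by
    rw [add_sub_cancel_left, hθ]; ring
  refine ⟨u, hsol, ⟨?_, ?_, fun i => ?_, fun i => ?_, fun i => ?_, fun i => ?_, fun i => ?_,
    fun i hi0 hiL => ?_⟩⟩
  · rw [hphase 0 ⟨le_rfl, hL0.le⟩]
    exact ⟨hann 0 (Nat.zero_le _) 0 (by simpa using hτ.le), hq₀ hw0r⟩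
  · rw [hphase L ⟨hL0.le, le_rfl⟩]
    exact ⟨hann m le_rfl L ⟨by rw [hL]; linarith, by rw [hL]⟩, hq_L hwLr⟩
  · obtain ⟨hρi, hηi, hwGi⟩ := hwG i i.2
    rw [hsi, hphase _ (hhump i i.2.le ⟨by linarith, le_rfl⟩)]
    refine ⟨hann i i.2.le _ ⟨by linarith, le_rfl⟩, ?_⟩
    rw [hwGi _ ⟨le_rfl, by rw [hgapς]; linarith⟩, heκ, sub_self, mul_zero, add_zero]
    refine (κ i).sign_smul_mem_source ?_ ?_
    · exact mul_nonpos_of_nonneg_of_nonpos (by positivity)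
        (Real.sin_nonpos_of_nonpos_of_neg_pi_le hηi.2.le (by linarith [hηi.1]))
    · exact mul_nonneg hρi.le
        (Real.cos_nonneg_of_mem_Icc ⟨by linarith [hηi.1], by linarith [hηi.2]⟩)
  · obtain ⟨hρi, hηi, hwGi⟩ := hwG i i.2
    rw [hti, hphase _ (hhump (i + 1) i.2 ⟨le_rfl, by linarith⟩)]
    refine ⟨hann (i + 1) i.2 _ ⟨le_rfl, by linarith⟩, ?_⟩
    rw [hw_hump (i + 1) i.2 _ ⟨le_rfl, by linarith⟩, heκ, hA0]
    have hang := (hlink i i.2).angle_right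
    refine (κ i).sign_smul_mem_region ?_ ?_
    · exact O.coordInv_nonneg.2 (mul_nonneg (Real.sqrt_nonneg _)
        (Real.sin_nonneg_of_nonneg_of_le_pi hang.1.le (by linarith [hang.2])))
    · exact mul_nonneg (Real.sqrt_nonneg _)
        (Real.cos_nonneg_of_mem_Icc ⟨by linarith [hang.1], hang.2.le⟩)
  · obtain ⟨hρi, hηi, hwGi⟩ := hwG i i.2
    -- The linear angle runs from η in (−θ, 0) to η + θ + 2πξ in (2πξ, 2πξ + θ), passing 0, π, …,
    -- 2ξπ.
    have h := encard_sin_eq_zero (k₀ := 0) (N := 2 * ξ + 1)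
      (by linarith : (i : ℕ) * (τ + ς) + τ ≤ (i : ℕ) * (τ + ς) + τ + ς)
      ((hgapmono i).strictMonoOn _) (by fun_prop)
      (by simp only [sub_self]; push_cast; linarith [hηi.1])
      (by simp only [sub_self]; push_cast; linarith [hηi.2])
      (by simp only [hgapend]; push_cast; linarith [hηi.1])
      (by simp only [hgapend]; push_cast; linarith [hηi.2])
    rw [← h]
    congr 1
    ext x
    rw [mem_ofPred_eq, mem_ofPred_eq, hsi, hti, hgapς]
    refine and_congr_right fun hx => ?_
    have hx' : x ∈ Icc ((i : ℕ) * (τ + ς) + τ) (((i : ℕ) + 1 : ℕ) * (τ + ς)) := by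
      rw [hgapς]; exact Ioo_subset_Icc_self hx
    simp only [hu_def, hwGi x hx', gapPoint, Prod.smul_mk, smul_eq_mul, mul_eq_zero, hene, hρi.ne',
      hsl.ne', div_eq_zero_iff, false_or]
  · obtain ⟨hρi, hηi, hwGi⟩ := hwG i i.2
    have h := encard_cos_eq_zero (N := 2 * ξ)
      (by linarith : (i : ℕ) * (τ + ς) + τ ≤ (i : ℕ) * (τ + ς) + τ + ς)
      ((hgapmono i).strictMonoOn _) (by fun_prop)
      (by simp only [sub_self]; linarith [hηi.1])
      (by simp only [sub_self]; linarith [hηi.2])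
      (by simp only [hgapend]; push_cast; linarith [hηi.1])
      (by simp only [hgapend]; push_cast; linarith [hηi.2])
    rw [← h]
    congr 1
    ext x
    rw [mem_ofPred_eq, mem_ofPred_eq, hsi, hti, hgapς]
    refine and_congr_right fun hx => ?_
    have hx' : x ∈ Icc ((i : ℕ) * (τ + ς) + τ) (((i : ℕ) + 1 : ℕ) * (τ + ς)) := by
      rw [hgapς]; exact Ioo_subset_Icc_self hx
    rw [hslope' x (hgap i i.2 hx')]
    simp only [hv_def, hwGi x hx', gapPoint, Prod.smul_mk, smul_eq_mul, mul_eq_zero, hene, hρi.ne',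
      false_or]
  · have hi : (i : ℕ) ≤ m := Nat.lt_succ_iff.1 i.2
    have h := encard_sin_eq_zero_of_shift (N := N i)
      (by linarith : ((i : ℕ) : ℝ) * (τ + ς) < (i : ℕ) * (τ + ς) + τ)
      ((hAmono i).strictMonoOn _) (hAcont i).continuousOn (hd1 i) (hd1' i)
      (by rw [hA0]; exact hφ i hi) (by rw [hA1]; exact hψ i hi)
    rw [← h]
    congr 1
    ext x
    have hd_iff : d i = 1 ↔ i = 0 ∧ (q₀ = .II ∨ q₀ = .IV) := by
      rw [← Quadrant.shift_eq_one_iff, Fin.ext_iff, Fin.val_zero]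
      simp only [hd]
      split_ifs with h <;> simp [h]
    have hd_iff' : d' i = 0 ↔ i = Fin.last m ∧ (q_L = .I ∨ q_L = .III) := by
      rw [← Quadrant.shift_eq_zero_iff, Fin.ext_iff, Fin.val_last]
      simp only [hd']
      split_ifs with h <;> simp [h]
    rw [mem_ofPred_eq, mem_ofPred_eq, humpTimes, mem_ofPred_eq, ht i, hs i, hd_iff, hd_iff']
    refine and_congr_right fun hx => ?_
    have hsq : √(2 * (f i).1) ≠ 0 :=
      (Real.sqrt_pos.2 (by linarith [(hcmem i hi).1])).ne'
    simp only [hu_def, hw_hump i hi x hx.1, point, Prod.smul_mk, smul_eq_mul, mul_eq_zero, hene,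
      coordInv_eq_zero, hsq, false_or]
  · have hi : (i : ℕ) < m := lt_of_le_of_ne (Nat.lt_succ_iff.1 i.2) fun h => hiL (Fin.ext h)
    obtain ⟨k, hk⟩ : ∃ k, (i : ℕ) = k + 1 :=
      Nat.exists_eq_succ_of_ne_zero fun h => hi0 (Fin.ext h)
    have hang : (f i).2 ∈ Ioo 0 (Real.pi / 2) := by
      rw [hk]
      exact (hlink k (by omega)).angle_right
    have hrm := (hlink i hi).rot_mem
    -- On an inner hump the angle runs from (0, π/2) to (Nπ + π/2, (N+1)π), passing N + 1 odd
    -- multiples of π/2.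
    have h := encard_cos_eq_zero (N := N i + 1)
      (by linarith : ((i : ℕ) : ℝ) * (τ + ς) ≤ (i : ℕ) * (τ + ς) + τ)
      ((hAmono i).strictMonoOn _) (hAcont i).continuousOn
      (by rw [hA0]; linarith [hang.1]) (by rw [hA0]; exact hang.2)
      (by rw [hA1]; push_cast; linarith [hrm.1]) (by rw [hA1]; push_cast; linarith [hrm.2])
    rw [← h]
    congr 1
    ext x
    rw [mem_ofPred_eq, mem_ofPred_eq, ht i, hs i]
    refine and_congr_right fun hx => ?_
    have hx' := Ioo_subset_Icc_self hx
    have hsq : √(2 * (f i).1) ≠ 0 :=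
      (Real.sqrt_pos.2 (by linarith [(hcmem i hi.le).1])).ne'
    rw [hslope' x (hhump i hi.le hx')]
    simp only [hv_def, hw_hump i hi.le x hx', point, Prod.smul_mk, smul_eq_mul, mul_eq_zero, hene,
      hsq, false_or]

end Oscillator
end MooreNehari

/-! ### The gap condition as an angle, node counts, and distinctness -/

namespace MooreNehari

theorem integral_one_div_sqrt {lam c X : ℝ} (hlam : 0 < lam) (hc : 0 < c) (hX0 : 0 ≤ X)
    (hX : X < √(2 * c / lam)) :
    ∫ x in (0 : ℝ)..X, 1 / √(2 * c - lam * x ^ 2) = Real.arcsin (X / √(2 * c / lam)) / √lam := by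
  have hR : 0 < √(2 * c / lam) := Real.sqrt_pos.2 (by positivity)
  have hR2 : √(2 * c / lam) ^ 2 = 2 * c / lam := Real.sq_sqrt (by positivity)
  set R := √(2 * c / lam) with hRdef
  have hs : 0 < √lam := Real.sqrt_pos.2 hlam
  have h2c : 2 * c = lam * R ^ 2 := by rw [hR2]; field_simp
  have hpos : ∀ x ∈ uIcc 0 X, 0 < 2 * c - lam * x ^ 2 := fun x hx => by
    rw [uIcc_of_le hX0] at hx
    have : x ^ 2 < R ^ 2 := pow_lt_pow_left₀ (hx.2.trans_lt hX) hx.1 two_ne_zero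
    rw [h2c]
    nlinarith
  have hderiv : ∀ x ∈ uIcc 0 X, HasDerivAt (fun x => Real.arcsin (x / R) / √lam)
      (1 / √(2 * c - lam * x ^ 2)) x := fun x hx => by
    rw [uIcc_of_le hX0] at hx
    have hlt : x / R < 1 := (div_lt_one hR).2 (hx.2.trans_lt hX)
    have hge : 0 ≤ x / R := div_nonneg hx.1 hR.le
    have h := ((Real.hasDerivAt_arcsin (x := x / R) (by linarith) hlt.ne).comp x
      ((hasDerivAt_id x).div_const R)).div_const (√lam)
    refine HasDerivAt.congr_deriv h ?_
    have e1 : 2 * c - lam * x ^ 2 = lam * (R ^ 2 * (1 - (x / R) ^ 2)) := by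
      rw [h2c]; field_simp
    rw [e1, Real.sqrt_mul hlam.le, Real.sqrt_mul (by positivity), Real.sqrt_sq hR.le]
    have : √(1 - (x / R) ^ 2) ≠ 0 := (Real.sqrt_pos.2 (by nlinarith)).ne'
    field_simp
  have hint : IntervalIntegrable (fun x => 1 / √(2 * c - lam * x ^ 2)) volume 0 X :=
    (ContinuousOn.div continuousOn_const (by fun_prop) fun x hx =>
      (Real.sqrt_pos.2 (hpos x hx)).ne').intervalIntegrable
  rw [intervalIntegral.integral_eq_sub_of_hasDerivAt hderiv hint]
  simp

theorem xCom_lt_of_gap_bounds {lam μ p ς c₁ c₂ : ℝ} {ξ : ℕ} (hlam : 0 < lam) (hμ : 0 < μ)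
    (hp : 1 < p) (hc₁ : 0 < c₁) (hc : c₁ < c₂) (hcompat : √(2 * c₁ / lam) > xCom μ p c₁ c₂)
    (hgap_lower : 2 * (∫ x in (0 : ℝ)..xCom μ p c₁ c₂, 1 / √(2 * c₁ - lam * x ^ 2))
      + 2 * Real.pi * ξ / √lam ≤ ς)
    (hgap_upper : ς ≤ Real.pi / (2 * √lam) + 2 * Real.pi * ξ / √lam) :
    0 < √lam * ς - ξ * (2 * Real.pi) ∧ √lam * ς - ξ * (2 * Real.pi) ≤ Real.pi / 2 ∧
      xCom μ p c₁ c₂ < √(2 * c₁ / lam) * Real.sin (√lam * ς - ξ * (2 * Real.pi)) := by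
  have hs : 0 < √lam := Real.sqrt_pos.2 hlam
  have hX : 0 < xCom μ p c₁ c₂ := by
    have : 0 < c₂ - c₁ := by linarith
    have : 0 < p + 1 := by linarith
    unfold xCom
    positivity
  have hR : 0 < √(2 * c₁ / lam) := hX.trans hcompat
  rw [integral_one_div_sqrt hlam hc₁ hX.le hcompat] at hgap_lower
  set φ := Real.arcsin (xCom μ p c₁ c₂ / √(2 * c₁ / lam)) with hφ
  set θ := √lam * ς - ξ * (2 * Real.pi) with hθ
  have hφ0 : 0 < φ := Real.arcsin_pos.2 (by positivity)
  have hlow : 2 * φ ≤ θ := by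
    have h := mul_le_mul_of_nonneg_left hgap_lower hs.le
    have e : √lam * (2 * (φ / √lam) + 2 * Real.pi * ξ / √lam) = 2 * φ + ξ * (2 * Real.pi) := by
      field_simp
    rw [e] at h
    linarith
  have hup : θ ≤ Real.pi / 2 := by
    have h := mul_le_mul_of_nonneg_left hgap_upper hs.le
    have e : √lam * (Real.pi / (2 * √lam) + 2 * Real.pi * ξ / √lam) =
        Real.pi / 2 + ξ * (2 * Real.pi) := by
      field_simp
    rw [e] at h
    linarith
  refine ⟨by linarith, hup, ?_⟩
  -- φ is the angle at which the ellipse of linear energy c₁ reaches x_com. Only θ > φ is needed,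
  -- which follows from θ ≥ 2φ and φ > 0.
  have hsin : Real.sin φ < Real.sin θ :=
    Real.sin_lt_sin_of_lt_of_le_pi_div_two (Real.neg_pi_div_two_le_arcsin _) hup (by linarith)
  have hle : xCom μ p c₁ c₂ / √(2 * c₁ / lam) < 1 := (div_lt_one hR).2 hcompat
  have hge : 0 ≤ xCom μ p c₁ c₂ / √(2 * c₁ / lam) := by positivity
  rw [hφ, Real.sin_arcsin (by linarith) hle.le, div_lt_iff₀ hR] at hsin
  linarith

/-- The N crossings of the y-axis on the hump and the odd number on the gap decide the side
together. -/
theorem Block.sign_eq_mul_neg_one_pow {b b' : Block} {N : ℕ} (h : b = b' → Odd N)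
    (h' : b ≠ b' → Even N) : b'.sign = b.sign * (-1) ^ (N + 1) := by
  by_cases hb : b = b'
  · subst hb
    rw [(h rfl).add_one.neg_one_pow, mul_one]
  · rw [(h' hb).add_one.neg_one_pow]
    cases b <;> cases b' <;> simp_all [Block.sign]

theorem Block.eq_of_mem_region {b b' : Block} {z : ℝ × ℝ} (h : z ∈ b.quadrant.region)
    (h' : z ∈ b'.quadrant.region) (hz : z ≠ 0) : b = b' := by
  have key : ∀ z : ℝ × ℝ, z ∈ Quadrant.region .I → z ∈ Quadrant.region .III → z = 0 :=
    fun z h h' => Prod.ext (le_antisymm h'.1 h.1) (le_antisymm h'.2 h.2)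
  cases b <;> cases b'
  · rfl
  · exact absurd (key z h h') hz
  · exact absurd (key z h' h) hz
  · rfl

/-- The two blocks as truth values. -/
def Block.equivBool : Block ≃ Bool where
  toFun
    | .I => true
    | .III => false
  invFun
    | true => .I
    | false => .III
  left_inv b := by cases b <;> rfl
  right_inv b := by cases b <;> rfl

instance : Finite Block := Finite.of_equiv _ Block.equivBool.symm

theorem Block.natCard : Nat.card Block = 2 := by
  rw [Nat.card_congr Block.equivBool]
  simp

open Classical in
/-- The number of zeros on a hump: `humpNodes`, except for a single hump whose initial quadrant
comes later in its half-plane than the final quadrant, where one more half turn may be needed. -/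
noncomputable def nodeCount (m : ℕ) (q₀ q_L : Quadrant) (α j : ℕ) (b b' : Block) : ℕ :=
  if m = 0 ∧ q₀.shift = 1 ∧ q_L.shift = 0 ∧ b = b' then 2 * (α + j) + 1 else humpNodes α j b b'

theorem odd_nodeCount {m : ℕ} {q₀ q_L : Quadrant} {α j : ℕ} {b b' : Block} (hj : 1 ≤ j)
    (h : b = b') : Odd (nodeCount m q₀ q_L α j b b') := by
  unfold nodeCount humpNodes
  rw [if_pos h]
  split_ifs
  · exact ⟨α + j, rfl⟩
  · exact ⟨α + j - 1, by omega⟩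

theorem even_nodeCount {m : ℕ} {q₀ q_L : Quadrant} {α j : ℕ} {b b' : Block}
    (h : b ≠ b') : Even (nodeCount m q₀ q_L α j b b') := by
  unfold nodeCount humpNodes
  rw [if_neg h, if_neg fun h' => h h'.2.2.2]
  exact ⟨α + j, by ring⟩

theorem nodeCount_injective {m : ℕ} {q₀ q_L : Quadrant} {α j j' : ℕ} {b b' : Block}
    (hj' : 1 ≤ j') (h : nodeCount m q₀ q_L α j b b' = nodeCount m q₀ q_L α j' b b') : j = j' := by
  unfold nodeCount humpNodes at h
  split_ifs at h <;> omega

/-- An inner hump requires 2α+1 ≤ N ≤ 2β. On an end hump an initial quadrant with shift 1 or a final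
one with shift 0 costs one quarter turn, hence 4α+1 instead of 4α+2. For a single hump both losses
may occur; N = 2α+1 is then too small, and the exceptional value 2(α+j)+1 still satisfies the upper
bound. -/
theorem nodeCount_bounds {m i : ℕ} {q₀ q_L : Quadrant} {α β j : ℕ} {b b' : Block} (him : i ≤ m)
    (hj : 1 ≤ j) (hjβ : α + j ≤ β) :
    ((if i = 0 then q₀.shift else 0) + 1 + (if i = 0 ∨ i = m then 4 * α + 1 else 4 * α + 2) ≤
      2 * nodeCount m q₀ q_L α j b b' + if i = m then q_L.shift else 1) ∧
    2 * nodeCount m q₀ q_L α j b b' + (if i = m then q_L.shift else 1) + 1 ≤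
      (if i = 0 then q₀.shift else 0) + (4 * β + 2) := by
  have h0 := q₀.shift_le_one
  have h1 := q_L.shift_le_one
  unfold nodeCount humpNodes
  by_cases hb : b = b'
  · simp only [eq_true hb, if_true, and_true]
    split_ifs <;> omega
  · simp only [hb, if_false, and_false]
    split_ifs <;> omega

theorem HasNodes.hasItinerary {m : ℕ} {t s : Fin (m + 1) → ℝ} {A : Set (ℝ × ℝ)}
    {q₀ q_L : Quadrant} {α ξ : ℕ} {κ : Fin m → Block} {N : ℕ → ℕ} {j : Fin (m + 1) → ℕ} {u : ℝ → ℝ}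
    (h : HasNodes t s A q₀ q_L ξ κ N u)
    (hN : 1 ≤ m → ∀ i : Fin (m + 1), N i = humpNodes α (j i)
      (fullItinerary q₀ q_L κ i.castSucc) (fullItinerary q₀ q_L κ i.succ)) :
    HasItinerary t s A q₀ q_L α ξ κ j u where
  initial := h.initial
  final := h.final
  gap_start := h.gap_start
  gap_end := h.gap_end
  gap_zeros := h.gap_zeros
  gap_slope_zeros := h.gap_slope_zeros
  hump_zeros hm i := by rw [h.hump_zeros, hN hm]
  hump_slope_zeros i h0 hL := by
    have hm : 1 ≤ m := by
      by_contra hm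
      exact h0 (Fin.ext (by have := i.2; rw [Fin.val_zero]; omega))
    rw [h.hump_slope_zeros i h0 hL, hN hm]

/-- The two blocks share only the origin, which the annulus avoids, so the phase point at the end of
a gap determines κ; N is a number of zeros of u. -/
theorem HasNodes.eq_of_eqOn {m : ℕ} {t s : Fin (m + 1) → ℝ} {lam μ p c₁ c₂ : ℝ}
    {q₀ q_L : Quadrant} {ξ : ℕ} {κ κ' : Fin m → Block} {N N' : ℕ → ℕ} {u u' : ℝ → ℝ}
    (hc₁ : 0 < c₁) (hp : 1 < p) (h : HasNodes t s (annulus lam μ p c₁ c₂) q₀ q_L ξ κ N u)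
    (h' : HasNodes t s (annulus lam μ p c₁ c₂) q₀ q_L ξ κ' N' u')
    (hts : ∀ i, Icc (t i) (s i) ⊆ Icc 0 (s (Fin.last m))) (htle : ∀ i, t i ≤ s i)
    (huu' : EqOn u u' (Icc 0 (s (Fin.last m)))) :
    κ = κ' ∧ ∀ i : Fin (m + 1), N i = N' i := by
  refine ⟨funext fun i => ?_, fun i => ?_⟩
  · have hmem : t i.succ ∈ Icc 0 (s (Fin.last m)) := hts i.succ ⟨le_rfl, htle _⟩
    have hph : phase (s (Fin.last m)) u (t i.succ) = phase (s (Fin.last m)) u' (t i.succ) :=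
      Prod.ext (huu' hmem) (derivWithin_congr huu' (huu' hmem))
    have h1 := h.gap_end i
    have h2 := h'.gap_end i
    rw [← hph] at h2
    refine Block.eq_of_mem_region h1.2 h2.2 fun h0 => ?_
    have h3 := h1.1.1
    have hp1 : p + 1 ≠ 0 := by linarith
    rw [h0] at h3
    simp [hamiltonian, potential, Real.zero_rpow hp1] at h3
    linarith
  · have h1 := h.hump_zeros i
    have h2 := h'.hump_zeros i
    have h3 : {x | x ∈ humpTimes t s q₀ q_L i ∧ u x = 0} =
        {x | x ∈ humpTimes t s q₀ q_L i ∧ u' x = 0} := by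
      ext x
      refine and_congr_right fun hx => ?_
      rw [huu' (hts i hx.1)]
    rw [h3, h2] at h1
    exact_mod_cast h1.symm

end MooreNehari

/-! ### Assembly of the main theorem -/

theorem corollary7p2 (lam p μ τ ς c₁ c₂ : ℝ) (m α β ξ : ℕ) (t s : Fin (m + 1) → ℝ)
    (r₀ r_L : Set (ℝ × ℝ)) (q₀ q_L : Quadrant)
    (hlam : 0 < lam) (hp : 1 < p) (hμ : 0 < μ) (hτ : 0 < τ) (hς : 0 < ς)
    (ht : t 0 = 0)
    (hhump : ∀ i : Fin (m + 1), s i - t i = τ)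
    (hgap : ∀ i : Fin m, t i.succ - s i.castSucc = ς)
    (hr₀ : IsUnboundedArc r₀) (hq₀ : r₀ ⊆ q₀.region)
    (hr_L : IsUnboundedArc r_L) (hq_L : r_L ⊆ q_L.region)
    (hc₁ : 0 < c₁) (hc : c₁ < c₂) (hαβ : α < β)
    (htwist_inner : ∀ i : Fin (m + 1), i ≠ 0 → i ≠ Fin.last m →
      (α + 1 / 2) * energyPeriod lam μ p c₁ > τ ∧ τ > (β + 1 / 2) * energyPeriod lam μ p c₂)
    (htwist_outer : ∀ i : Fin (m + 1), i = 0 ∨ i = Fin.last m →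
      (α + 1 / 4) * energyPeriod lam μ p c₁ > τ ∧ τ > (β + 1 / 2) * energyPeriod lam μ p c₂)
    (hcompat : √(2 * c₁ / lam) > xCom μ p c₁ c₂)
    (hgap_lower : 2 * (∫ x in (0 : ℝ)..xCom μ p c₁ c₂, 1 / √(2 * c₁ - lam * x ^ 2))
      + 2 * Real.pi * ξ / √lam ≤ ς)
    (hgap_upper : ς ≤ Real.pi / (2 * √lam) + 2 * Real.pi * ξ / √lam) :
    ((2 ^ m * (β - α) ^ (m + 1) : ℕ) : ℕ∞) ≤
        ((Icc 0 (s (Fin.last m))).domRestrict ''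
          {u : ℝ → ℝ | IsSolution lam p (s (Fin.last m)) (stepWeight t s fun _ => μ)
            r₀ r_L u}).encard ∧
    ∃ U : (Fin m → Block) → (Fin (m + 1) → Fin (β - α)) → ℝ → ℝ,
      (∀ κ j, IsSolution lam p (s (Fin.last m)) (stepWeight t s fun _ => μ) r₀ r_L (U κ j)) ∧
      (∀ κ j κ' j', EqOn (U κ j) (U κ' j') (Icc 0 (s (Fin.last m))) → κ = κ' ∧ j = j') ∧
      ∀ κ j, HasItinerary t s (annulus lam μ p c₁ c₂) q₀ q_L α ξ κ
        (fun i => (j i : ℕ) + 1) (U κ j) := by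
  let O : Oscillator := ⟨lam, μ, p, hlam, hμ, hp⟩
  have ht' : ∀ i, t i = (i : ℕ) * (τ + ς) := by
    intro i
    induction i using Fin.induction with
    | zero => simp [ht]
    | succ i ih =>
      have h1 := hhump i.castSucc
      have h2 := hgap i
      rw [Fin.val_castSucc] at ih
      rw [Fin.val_succ]
      push_cast
      linarith
  have hs' : ∀ i, s i = (i : ℕ) * (τ + ς) + τ := fun i => by linarith [hhump i, ht' i]
  obtain ⟨hθ0, hθ2, hcom⟩ := xCom_lt_of_gap_bounds hlam hμ hp hc₁ hc hcompat hgap_lower hgap_upper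
  have hT₁ : energyPeriod lam μ p c₁ = 4 * O.quarter c₁ := O.energyPeriod_eq hc₁
  have hT₂ : energyPeriod lam μ p c₂ = 4 * O.quarter c₂ := O.energyPeriod_eq (hc₁.trans hc)
  -- The factors α + 1/4, α + 1/2 and β + 1/2 of the full period, expressed in quarter periods.
  set k : ℕ → ℕ := fun i => if i = 0 ∨ i = m then 4 * α + 1 else 4 * α + 2 with hk
  have h₁ : ∀ i ≤ m, τ < k i * O.quarter c₁ := fun i hi => by
    simp only [hk]
    split_ifs with h
    · have := (htwist_outer ⟨i, by omega⟩ (h.imp (fun h => Fin.ext h) fun h => Fin.ext h)).1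
      rw [hT₁] at this
      push_cast
      linarith
    · rw [not_or] at h
      have := (htwist_inner ⟨i, by omega⟩ (fun h' => h.1 (congrArg Fin.val h'))
        fun h' => h.2 (congrArg Fin.val h')).1
      rw [hT₁] at this
      push_cast
      linarith
  have h₂ : ∀ i ≤ m, ((4 * β + 2 : ℕ) : ℝ) * O.quarter c₂ < τ := fun i hi => by
    have := (htwist_outer 0 (Or.inl rfl)).2
    rw [hT₂] at this
    push_cast
    linarith
  have main : ∀ (κ : Fin m → Block) (j : Fin (m + 1) → Fin (β - α)), ∃ (u : ℝ → ℝ) (N : ℕ → ℕ),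
      (∀ i : Fin (m + 1), N i = nodeCount m q₀ q_L α ((j i : ℕ) + 1)
        (fullItinerary q₀ q_L κ i.castSucc) (fullItinerary q₀ q_L κ i.succ)) ∧
      IsSolution lam p (s (Fin.last m)) (stepWeight t s fun _ => μ) r₀ r_L u ∧
      HasNodes t s (annulus lam μ p c₁ c₂) q₀ q_L ξ κ N u := fun κ j => by
    -- Elements of `Fin (β - α)` start at 0, while j starts at 1; indices beyond m are reduced
    -- modulo m + 1 and never matter.
    let N : ℕ → ℕ := fun n => nodeCount m q₀ q_L α ((j (Fin.ofNat (m + 1) n) : ℕ) + 1)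
      (fullItinerary q₀ q_L κ (Fin.ofNat (m + 1) n).castSucc)
      (fullItinerary q₀ q_L κ (Fin.ofNat (m + 1) n).succ)
    have hN : ∀ i : Fin (m + 1), N i = nodeCount m q₀ q_L α ((j i : ℕ) + 1)
        (fullItinerary q₀ q_L κ i.castSucc) (fullItinerary q₀ q_L κ i.succ) := fun i => by
      simp only [N, Fin.ofNat_val_eq_self]
    have hjβ : ∀ i, α + ((j i : ℕ) + 1) ≤ β := fun i => by have := (j i).2; omega
    obtain ⟨u, hu, hn⟩ := O.exists_solution κ (N := N) (ξ := ξ) (k₁ := k) (k₂ := fun _ => 4 * β + 2) hτ hς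
      ht' hs' hr₀ hq₀ hr_L hq_L hc₁ hc hθ0 hθ2 (by simp [O]) hcom
      (fun i => by
        rw [hN]
        exact Block.sign_eq_mul_neg_one_pow (odd_nodeCount (by omega)) even_nodeCount)
      h₁ h₂ (fun i hi => (nodeCount_bounds hi (by omega) (hjβ _)).1)
      (fun i hi => (nodeCount_bounds hi (by omega) (hjβ _)).2)
    exact ⟨u, N, hN, hu, hn⟩
  choose U N hN hU hnodes using main
  have hinj : ∀ κ j κ' j', EqOn (U κ j) (U κ' j') (Icc 0 (s (Fin.last m))) → κ = κ' ∧ j = j' := by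
    intro κ j κ' j' h
    have hτς : 0 < τ + ς := by linarith
    obtain ⟨rfl, hNN⟩ := (hnodes κ j).eq_of_eqOn hc₁ hp (hnodes κ' j')
      (fun i => by
        have hi : ((i : ℕ) : ℝ) ≤ m := by exact_mod_cast Nat.lt_succ_iff.1 i.2
        rw [ht', hs', hs', Fin.val_last]
        exact Icc_subset_Icc (by positivity)
          (by linarith [mul_le_mul_of_nonneg_right hi hτς.le]))
      (fun i => by linarith [hhump i]) h
    refine ⟨rfl, funext fun i => Fin.ext ?_⟩
    have h1 := hNN i
    rw [hN, hN] at h1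
    have := nodeCount_injective (by omega) h1
    omega
  refine ⟨?_, U, hU, hinj, fun κ j => (hnodes κ j).hasItinerary fun hm i => ?_⟩
  -- Solutions are counted after restriction to [0, L], since their values elsewhere are arbitrary.
  · let g : (Fin m → Block) × (Fin (m + 1) → Fin (β - α)) → Icc 0 (s (Fin.last m)) → ℝ :=
      fun q => (Icc 0 (s (Fin.last m))).domRestrict (U q.1 q.2)
    have hg : Function.Injective g := fun q q' h => by
      have h' := hinj q.1 q.2 q'.1 q'.2 fun x hx => congrFun h ⟨x, hx⟩
      exact Prod.ext h'.1 h'.2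
    have hcard : (range g).encard = ((2 ^ m * (β - α) ^ (m + 1) : ℕ) : ℕ∞) := by
      rw [← image_univ, hg.encard_image, encard_univ, ENat.card_eq_coe_natCard, Nat.card_prod,
        Nat.card_fun, Nat.card_fun, Block.natCard]
      simp
    rw [← hcard]
    refine encard_le_encard ?_
    rintro _ ⟨q, rfl⟩
    exact ⟨_, hU q.1 q.2, rfl⟩
  · rw [hN, nodeCount, if_neg (by omega)]
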